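/- All groups and graphs are finite and graphs are simple. For a positive integer $d$, let $\mathcal A(d)$ be the family of pairs $(\Gamma,G)$ where $\Gamma$ is a connected graph of valency at most $d$ and $G\le\mathrm{Aut}(\Gamma)$ is transitive on the vertex set $V\Gamma$. Two pairs $(\Gamma,G)$, $(\Gamma',G')$ are isomorphic if some graph isomorphism $\Gamma\to\Gamma'$ conjugates $G$ onto $G'$. For $f:\mathbb N\to\mathbb N$, a pair $(\Gamma,G)\in\mathcal A(d)$ is $f$-bounded if $|G_\alpha|\le f(d)$ for every $\alpha\in V\Gamma$. A permutation group is quasiprimitive if every non-identity normal subgroup of it is transitive, and biquasiprimitive if it is not quasiprimitive and every non-identity normal subgroup has at most two orbits. The socle factor of $G$ is the simple group $T$ (possibly abelian) such that the socle of $G$ (the subgroup generated by its minimal normal subgroups) is isomorphic to $T^l$ for some $l\ge1$. We write $(\Lambda,T)\in\mathcal A(d)$ for a pair $(\Lambda,L)\in\mathcal A(d)$ with $L\cong T$. For $f:\mathbb N\to\mathbb N$ and $d\geq 1$ put $\tilde f(d)=f(d')$, where $d'$ is the unique natural number with $(d'-1)(d'-2)<d\le d'(d'-1)$. For $g_1,g_2:\mathbb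 N\to\mathbb N$ put, with $d_0=d(d-1)$, $$\overline{g_1\ast g_2}(d)=\Bigl(d_0\,\bigl(g_1(d_0)g_2(d_0)\bigr)^{d_0^{d_0}\min\{g_1(d_0),g_2(d_0)\}^{2d_0}}\Bigr)!.$$ Theorem. To every pair $(\Gamma,G)$ one can assign two (possibly isomorphic) pairs $\Lambda_1(\Gamma,G)$, $\Lambda_2(\Gamma,G)$, each consisting of a graph and a group of automorphisms of it, so that isomorphic pairs $(\Gamma,G)$ are assigned the same unordered pair of isomorphism classes, and such that the following holds for every positive integer $d$. Let $(\Gamma,G)\in\mathcal A(d)$ with $G$ biquasiprimitive on $V\Gamma$ and with socle factor $T$. Then either (1) $|G_\alpha|\le (d^2((d(d-1))!)^2)!$ for every $\alpha\in V\Gamma$; or (2) the two assigned pairs are pairs $(\Lambda_1,T),(\Lambda_2,T)\in\mathcal A(d(d-1))$ with the following properties. For all $g_1,g_2:\mathbb N\to\mathbb N$, if $(\Lambda_i,T)$ is $g_i$-bounded for $i=1,2$, then $(\Gamma,G)$ is $\overline{g_1\ast g_2}$-bounded. Conversely, for every $f:\mathbb N\to\mathbb N$, if $(\Gamma,G)$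 is $f$-bounded, then each of $(\Lambda_1,T)$, $(\Lambda_2,T)$ is $\tilde f$-bounded. -/

import Mathlib

open scoped Nat

universe u v

/-! ### Permutation groups -/

/-- Quasiprimitivity: every non-identity normal subgroup is transitive. -/
def IsQuasiprimitive (G : Type*) (X : Type*) [Group G] [MulAction G X] : Prop :=
  ∀ N : Subgroup G, N.Normal → N ≠ ⊥ → MulAction.IsPretransitive N X

/-- For faithful transitive actions this is the Mathlib notion. -/
theorem isQuasiprimitive_iff (G : Type*) (X : Type*) [Group G] [MulAction G X]
    [FaithfulSMul G X] [MulAction.IsPretransitive G X] :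
    IsQuasiprimitive G X ↔ MulAction.IsQuasiPreprimitive G X := by
  have key : ∀ N : Subgroup G, N ≠ ⊥ ↔ MulAction.fixedPoints N X ≠ .univ := by
    intro N
    refine not_congr ⟨?_, ?_⟩
    · rintro rfl
      ext x
      simp [MulAction.mem_fixedPoints, Subgroup.smul_def]
    · intro h
      rw [Subgroup.eq_bot_iff_forall]
      intro g hg
      refine FaithfulSMul.eq_of_smul_eq_smul (α := X) fun x => ?_
      have hx : x ∈ MulAction.fixedPoints N X := h ▸ Set.mem_univ x
      simpa [Subgroup.smul_def] using hx ⟨g, hg⟩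
  constructor
  · intro h
    exact ⟨fun {N} hN hf => h N hN ((key N).2 hf)⟩
  · intro h N hN hb
    exact h.isPretransitive_of_normal ((key N).1 hb)

/-- Biquasiprimitivity: not quasiprimitive, and every non-identity normal subgroup has at most two
orbits (used for groups acting on finite sets). -/
def IsBiquasiprimitive (G : Type*) (X : Type*) [Group G] [MulAction G X] : Prop :=
  ¬ IsQuasiprimitive G X ∧
    ∀ N : Subgroup G, N.Normal → N ≠ ⊥ → Nat.card (MulAction.orbitRel.Quotient N X) ≤ 2

/-- Minimal normal subgroups of a group. -/
def IsMinimalNormal {G : Type*} [Group G] (N : Subgroup G) : Prop :=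
  N.Normal ∧ N ≠ ⊥ ∧ ∀ K : Subgroup G, K.Normal → K ≤ N → K = ⊥ ∨ K = N

/-- The socle: the subgroup generated by all minimal normal subgroups. -/
def socle (G : Type*) [Group G] : Subgroup G :=
  sSup {N : Subgroup G | IsMinimalNormal N}

/-- `T` is the socle factor of `G`: it is a simple group (possibly abelian) and the socle of `G` is
isomorphic to a direct product of `l ≥ 1` copies of `T`. -/
def IsSocleFactor (G : Type*) [Group G] (T : Type*) [Group T] : Prop :=
  IsSimpleGroup T ∧ ∃ l : ℕ, 0 < l ∧ Nonempty (socle G ≃* (Fin l → T))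

/-! ### Pairs consisting of a finite graph and a group of automorphisms -/

/-- A finite simple graph together with a subgroup of its automorphism group. -/
structure GraphPair where
  V : Type u
  finite : Finite V
  graph : SimpleGraph V
  group : Subgroup (graph ≃g graph)

namespace GraphPair

/-- Isomorphism of pairs: a graph isomorphism that conjugates one group onto the other. -/
def Iso (P Q : GraphPair.{u}) : Prop :=
  ∃ e : P.graph ≃g Q.graph,
    ∀ h : Q.graph ≃g Q.graph, h ∈ Q.group ↔ (e.trans h).trans e.symm ∈ P.group

/-- Membership in the family `A(d)`: the graph is connected, the group is transitive on vertices,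
and the valency is at most `d`. -/
def InA (P : GraphPair.{u}) (d : ℕ) : Prop :=
  P.graph.Connected ∧ MulAction.IsPretransitive P.group P.V ∧
    ∀ x : P.V, (P.graph.neighborSet x).ncard ≤ d

/-- `f`-boundedness of a pair regarded as a member of `A(d)`: every vertex stabiliser has order at
most `f d`. -/
def IsBounded (P : GraphPair.{u}) (d : ℕ) (f : ℕ → ℕ) : Prop :=
  ∀ x : P.V, Nat.card (MulAction.stabilizer P.group x) ≤ f d

end GraphPair

/-! ### The bounding functions -/

/-- The function `d ↦ (d² ((d(d-1))!)²)!`. -/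
def absoluteBound (d : ℕ) : ℕ := (d ^ 2 * ((d * (d - 1))!) ^ 2)!

/-- The function denoted `g₁ ∗ g₂` with a bar:
`d ↦ (d₀ (g₁(d₀) g₂(d₀)) ^ (d₀ ^ d₀ min(g₁(d₀), g₂(d₀)) ^ (2 d₀)))!` with `d₀ = d(d-1)`. -/
def starBar (g₁ g₂ : ℕ → ℕ) (d : ℕ) : ℕ :=
  let d₀ := d * (d - 1)
  (d₀ * (g₁ d₀ * g₂ d₀) ^ (d₀ ^ d₀ * (min (g₁ d₀) (g₂ d₀)) ^ (2 * d₀)))!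

/-- The defining property of `d'`: `(d'-1)(d'-2) < d ≤ d'(d'-1)`, in the integers. -/
def IsTildeIndex (d e : ℕ) : Prop :=
  ((e : ℤ) - 1) * ((e : ℤ) - 2) < (d : ℤ) ∧ (d : ℤ) ≤ (e : ℤ) * ((e : ℤ) - 1)

theorem existsUnique_isTildeIndex {d : ℕ} (hd : 0 < d) : ∃! e : ℕ, IsTildeIndex d e := by
  classical
  have hex : ∃ e : ℕ, 1 ≤ e ∧ (d : ℤ) ≤ (e : ℤ) * ((e : ℤ) - 1) :=
    ⟨d + 1, by omega, by push_cast; nlinarith⟩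
  have hd' : (1 : ℤ) ≤ d := by exact_mod_cast hd
  obtain ⟨h1, h2⟩ := Nat.find_spec hex
  have hmin := fun m => @Nat.find_min _ _ hex m
  generalize Nat.find hex = e at *
  have he2 : 2 ≤ e := by
    by_contra hlt
    have : e = 1 := by omega
    subst this
    norm_num at h2
    omega
  have h3 : ((e : ℤ) - 1) * ((e : ℤ) - 2) < (d : ℤ) := by
    by_contra hle
    refine hmin (e - 1) (by omega) ⟨by omega, ?_⟩
    push_cast [Nat.cast_sub h1]
    linarith
  refine ⟨e, ⟨h3, h2⟩, ?_⟩
  rintro m ⟨hm1, hm2⟩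
  have hm : 2 ≤ m := by
    by_contra hlt
    have : m = 0 ∨ m = 1 := by omega
    rcases this with rfl | rfl
    · norm_num at hm2; omega
    · norm_num at hm2; omega
  zify at hm he2
  have : (m : ℤ) = e := by
    rcases lt_trichotomy (m : ℤ) e with h | h | h
    · nlinarith
    · exact h
    · nlinarith
  exact_mod_cast this

/-- The number `d'` attached to `d` (the unique number with the defining property if `d > 0`; the
value at `0` is irrelevant). -/
noncomputable def tildeIndex (d : ℕ) : ℕ := sInf {e : ℕ | IsTildeIndex d e}

theorem isTildeIndex_tildeIndex {d : ℕ} (hd : 0 < d) : IsTildeIndex d (tildeIndex d) :=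
  Nat.sInf_mem (existsUnique_isTildeIndex hd).exists

/-- The function `f̃(d) = f(d')`. -/
noncomputable def tilde (f : ℕ → ℕ) (d : ℕ) : ℕ := f (tildeIndex d)

/-! ### Simple quotients of finite groups -/

section SimpleQuotients

variable {A T : Type*} [Group A] [Group T]

/-! Biquasiprimitivity gives a minimal normal subgroup `M` with exactly two orbits. Since `M` lies
in the socle, some coordinate gives an epimorphism `π : M →* T`, and by minimality the
`G`-conjugates of `π` separate the points of `M`. Conjugating `π` by `g` amounts to moving vertices
by `g`, so the images of all vertex stabilisers under all conjugates are controlled by `π` alone.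
Fix an edge `{v, w}` crossing between the two orbits and write `M_v`, `M_vw` for the stabilisers in
`M`.

The order of `G_x` is bounded in terms of `d` and `|M_v|`: the stabiliser of a crossing edge acts
faithfully by conjugation on the elements of `M` moving an end of that edge next to it. So `|M_v|`
must be bounded. If `π` kills the stabiliser of some ball of radius one, or maps every `M_x` onto
`T`, then `|M_v|` is bounded in terms of `d` alone; valency at most two is treated directly. These
cases give alternative (1).

Otherwise `U = π(M_vw)` is proper and nontrivial. The graphs in (2) are coset graphs of `π⁻¹(U)` in
`M`: `M` induces `T` on them, with vertex stabilisers of order `|U|`. The vertices stand for the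
translates of the crossing edge, identified modulo `ker π`, and counting nearby translates bounds
the valency by `d(d-1)`. As `|U| ≤ |G_v|`, bounds pass from `G` to `T`. Conversely `|π(M_x)| ≤ d|U|`
for all `x`, and the number of kernels of conjugates of `π` is bounded by `ncard_ker_conjHom_le`:
conjugates that agree on finitely many recorded values and have different kernels would force
`π(M_x) = T` for every `x`. Since these kernels meet trivially, `|M_v|` is bounded. -/

theorem commutator_eq_top_of_simple [IsSimpleGroup T] (hT : ¬ ∀ a b : T, a * b = b * a) :
    ⁅(⊤ : Subgroup T), (⊤ : Subgroup T)⁆ = ⊤ := by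
  rcases (inferInstance : (⁅(⊤ : Subgroup T), (⊤ : Subgroup T)⁆).Normal).eq_bot_or_eq_top with h | h
  · exact absurd (fun a b => by
      have := Subgroup.commutator_mem_commutator (Subgroup.mem_top a) (Subgroup.mem_top b)
      rw [h, Subgroup.mem_bot, commutatorElement_eq_one_iff_mul_comm] at this
      exact this) hT
  · exact h

/-- A normal subgroup of `S` that covers every member of a separating family of nonabelian simple
quotients is the whole of `S`. -/
theorem le_of_map_eq_top {ι : Type*} [Finite ι] [IsSimpleGroup T]
    (hT : ¬ ∀ a b : T, a * b = b * a) (p : ι → A →* T) (hp : ∀ x, (∀ i, p i x = 1) → x = 1)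
    {Q S : Subgroup A} (hQS : Q ≤ S) (hn : ∀ s ∈ S, ∀ q ∈ Q, s * q * s⁻¹ ∈ Q)
    (hQ : ∀ i, Q.map (p i) = ⊤) : S ≤ Q := by
  classical
  have hS : ∀ i, S.map (p i) = ⊤ := fun i => top_le_iff.1 ((hQ i).ge.trans (Subgroup.map_mono hQS))
  -- An element of `S` is corrected by `Q` one quotient at a time.
  have key : ∀ s : Finset ι, ∀ x ∈ S, ∃ q ∈ Q, ∀ i ∈ s, p i (x * q⁻¹) = 1 := by
    intro s
    induction s using Finset.induction_on with
    | empty => exact fun x _ => ⟨1, Q.one_mem, by simp⟩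
    | insert j s hj ih =>
      intro x hx
      obtain ⟨q, hq, hqs⟩ := ih x hx
      by_cases hy : p j (x * q⁻¹) = 1
      · exact ⟨q, hq, fun i hi => (Finset.mem_insert.1 hi).elim (fun h => h ▸ hy) (hqs i)⟩
      let J : Subgroup A := S ⊓ ⨅ i ∈ s, (p i).ker
      have memJ : ∀ y, y ∈ J ↔ y ∈ S ∧ ∀ i ∈ s, p i y = 1 := by
        intro y
        simp [J, Subgroup.mem_iInf, MonoidHom.mem_ker]
      have hyJ : x * q⁻¹ ∈ J := (memJ _).2 ⟨S.mul_mem hx (S.inv_mem (hQS hq)), hqs⟩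
      have hJn : (J.map (p j)).Normal := by
        refine ⟨?_⟩
        rintro _ ⟨y, hy, rfl⟩ t
        obtain ⟨z, hz, rfl⟩ : t ∈ S.map (p j) := hS j ▸ Subgroup.mem_top t
        refine ⟨z * y * z⁻¹, (memJ _).2 ⟨?_, ?_⟩, by simp⟩
        · exact S.mul_mem (S.mul_mem hz ((memJ _).1 hy).1) (S.inv_mem hz)
        · intro i hi
          simp [((memJ _).1 hy).2 i hi]
      have hJ : J.map (p j) = ⊤ := by
        refine hJn.eq_bot_or_eq_top.resolve_left fun h => hy ?_
        have := Subgroup.mem_map_of_mem (p j) hyJ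
        rwa [h, Subgroup.mem_bot] at this
      -- The commutator subgroup of `Q` and `J` lies in `Q`, dies in the quotients already treated,
      -- and still covers the new one because `T` is perfect; it supplies the correction.
      have hc : (⁅Q, J⁆).map (p j) = ⊤ := by
        rw [Subgroup.map_commutator, hQ, hJ, commutator_eq_top_of_simple hT]
      have hcQ : ⁅Q, J⁆ ≤ Q := Subgroup.commutator_le.2 fun a ha b hb => by
        have := hn b ((memJ _).1 hb).1 a⁻¹ (Q.inv_mem ha)
        rw [commutatorElement_def]
        simpa [mul_assoc] using Q.mul_mem ha this
      have hck : ∀ i ∈ s, ⁅Q, J⁆ ≤ (p i).ker := fun i hi =>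
        Subgroup.commutator_le.2 fun a ha b hb => by
          simp [MonoidHom.mem_ker, commutatorElement_def, ((memJ _).1 hb).2 i hi]
      obtain ⟨c, hc, hcj⟩ : p j (x * q⁻¹) ∈ (⁅Q, J⁆).map (p j) := hc ▸ Subgroup.mem_top _
      refine ⟨c * q, Q.mul_mem (hcQ hc) hq, fun i hi => ?_⟩
      have e : x * (c * q)⁻¹ = (x * q⁻¹) * c⁻¹ := by group
      rw [e, map_mul, map_inv]
      rcases Finset.mem_insert.1 hi with rfl | hi
      · rw [hcj, mul_inv_cancel]
      · rw [hqs i hi, MonoidHom.mem_ker.1 (hck i hi hc), inv_one, mul_one]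
  intro x hx
  have := Fintype.ofFinite ι
  obtain ⟨q, hq, h⟩ := key Finset.univ x hx
  have := hp _ fun i => h i (Finset.mem_univ i)
  rwa [mul_inv_eq_one.1 this]

/-- Two epimorphisms onto a finite simple group with different kernels are independent. -/
theorem exists_map_eq_and_map_eq_one [Finite A] [IsSimpleGroup T] {p q : A →* T}
    (hp : Function.Surjective p) (hq : Function.Surjective q) (h : p.ker ≠ q.ker) (t : T) :
    ∃ a, p a = t ∧ q a = 1 := by
  have hn : (q.ker.map p).Normal := Subgroup.Normal.map inferInstance p hp
  rcases hn.eq_bot_or_eq_top with hb | ht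
  · refine absurd ?_ h
    -- Both kernels have index `|T|`, so inclusion forces equality.
    have hle : q.ker ≤ p.ker := (Subgroup.map_eq_bot_iff _).1 hb
    refine (Subgroup.eq_of_le_of_card_ge hle ?_).symm
    have h1 := p.ker.card_mul_index
    have h2 := q.ker.card_mul_index
    rw [Subgroup.index_ker, MonoidHom.range_eq_top.2 hp] at h1
    rw [Subgroup.index_ker, MonoidHom.range_eq_top.2 hq] at h2
    have : Finite T := Finite.of_surjective p hp
    exact (Nat.eq_of_mul_eq_mul_right Nat.card_pos (h1.trans h2.symm)).le
  · obtain ⟨a, ha, rfl⟩ : t ∈ q.ker.map p := ht ▸ Subgroup.mem_top t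
    exact ⟨a, rfl, ha⟩

/-- A nontrivial element of `N` has a nontrivial coordinate, and the image of `N` in that coordinate
is normal in a simple group. -/
theorem exists_surjective_eval {l : ℕ} [IsSimpleGroup T] (e : A ≃* (Fin l → T))
    (N : Subgroup A) [N.Normal] (hN : N ≠ ⊥) :
    ∃ i, Function.Surjective ((((Pi.evalMonoidHom (fun _ : Fin l => T) i).comp e.toMonoidHom).comp
      N.subtype)) := by
  by_contra hcon
  push Not at hcon
  refine hN ((Subgroup.eq_bot_iff_forall _).2 fun x hx => e.injective ?_)
  ext i
  have hn : (N.map ((Pi.evalMonoidHom (fun _ : Fin l => T) i).comp e.toMonoidHom)).Normal := by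
    refine Subgroup.Normal.map inferInstance _ ?_
    exact (Function.surjective_eval i).comp e.surjective
  have hx' := Subgroup.mem_map_of_mem
    ((Pi.evalMonoidHom (fun _ : Fin l => T) i).comp e.toMonoidHom) hx
  rcases hn.eq_bot_or_eq_top with h | h
  · rw [h, Subgroup.mem_bot] at hx'
    simpa using hx'
  · refine absurd ?_ (hcon i)
    rw [← MonoidHom.range_eq_top, MonoidHom.range_comp, Subgroup.range_subtype, h]

/-- Some factor maps nontrivially. It does so injectively because `T'` is simple, and its image is
normal in the simple group `T`. This makes the socle factor unique up to isomorphism. -/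
theorem nonempty_mulEquiv_of_surjective_pi {l : ℕ} {T' : Type*} [Group T'] [IsSimpleGroup T]
    [IsSimpleGroup T'] (f : (Fin l → T') →* T) (hf : Function.Surjective f) :
    Nonempty (T' ≃* T) := by
  classical
  obtain ⟨i, hi⟩ : ∃ i, f.comp (MonoidHom.mulSingle (fun _ => T') i) ≠ 1 := by
    by_contra hcon
    push Not at hcon
    have : f = 1 := MonoidHom.pi_ext fun i x => DFunLike.congr_fun (hcon i) x
    obtain ⟨t, ht⟩ := exists_ne (1 : T)
    obtain ⟨x, rfl⟩ := hf t
    exact ht (by rw [this]; rfl)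
  set p := f.comp (MonoidHom.mulSingle (fun _ => T') i)
  have hinj : Function.Injective p := by
    rw [← MonoidHom.ker_eq_bot_iff]
    refine (inferInstance : p.ker.Normal).eq_bot_or_eq_top.resolve_right fun h => hi ?_
    ext x
    exact (MonoidHom.mem_ker.1 (h ▸ Subgroup.mem_top x : x ∈ p.ker))
  have hsn : (MonoidHom.mulSingle (fun _ : Fin l => T') i).range.Normal := by
    refine ⟨?_⟩
    rintro _ ⟨x, rfl⟩ g
    refine ⟨g i * x * (g i)⁻¹, ?_⟩
    ext j
    by_cases hj : j = i
    · subst hj; simp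
    · simp [hj]
  have hrn : p.range.Normal := by
    rw [MonoidHom.range_comp]
    exact Subgroup.Normal.map hsn f hf
  have hsurj : Function.Surjective p := by
    rw [← MonoidHom.range_eq_top]
    refine hrn.eq_bot_or_eq_top.resolve_left fun h => hi ?_
    exact MonoidHom.range_eq_bot_iff.1 h
  exact ⟨MulEquiv.ofBijective p ⟨hinj, hsurj⟩⟩

end SimpleQuotients

/-! ### Minimal normal subgroups -/

section MinimalNormal

variable {G : Type*} [Group G]

theorem exists_isMinimalNormal_le [Finite G] (N : Subgroup G) (hN : N.Normal) (hb : N ≠ ⊥) :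
    ∃ M ≤ N, IsMinimalNormal M := by
  obtain ⟨M, ⟨hMN, hMn, hMb⟩, hmin⟩ := wellFounded_lt.has_min
    {M : Subgroup G | M ≤ N ∧ M.Normal ∧ M ≠ ⊥} ⟨N, le_rfl, hN, hb⟩
  refine ⟨M, hMN, hMn, hMb, fun K hK hKM => ?_⟩
  by_contra! h
  exact hmin K ⟨hKM.trans hMN, hK, h.1⟩ (lt_of_le_of_ne hKM h.2)

/-- The composite of a homomorphism on a normal subgroup with conjugation by `g`. -/
def conjHom {M : Subgroup G} [M.Normal] {T : Type*} [Group T] (π : M →* T) (g : G) : M →* T :=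
  π.comp (MulAut.conjNormal g : MulAut M).toMonoidHom

@[simp]
theorem conjHom_apply {M : Subgroup G} [M.Normal] {T : Type*} [Group T] (π : M →* T) (g : G)
    (a : M) : conjHom π g a = π (MulAut.conjNormal g a) := rfl

theorem conjHom_surjective {M : Subgroup G} [M.Normal] {T : Type*} [Group T] {π : M →* T}
    (hπ : Function.Surjective π) (g : G) : Function.Surjective (conjHom π g) :=
  hπ.comp (MulEquiv.surjective _)

theorem conjNormal_coe_apply {M : Subgroup G} [M.Normal] (a b : M) :
    MulAut.conjNormal (a : G) b = a * b * a⁻¹ :=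
  Subtype.ext (by simp)

/-- The extra factor only composes with an inner automorphism of `M`, which becomes conjugation in
`T`. Hence `g` may be adjusted modulo `M` when kernels are counted. -/
theorem ker_conjHom_coe_mul {M : Subgroup G} [M.Normal] {T : Type*} [Group T] (π : M →* T)
    (a : M) (g : G) : (conjHom π ((a : G) * g)).ker = (conjHom π g).ker := by
  ext x
  simp only [MonoidHom.mem_ker, conjHom_apply, map_mul, MulAut.mul_apply, conjNormal_coe_apply]
  simp [conj_eq_one_iff]

/-- The conjugates of an epimorphism of a minimal normal subgroup separate its elements. -/
theorem eq_one_of_conjHom_eq_one {M : Subgroup G} [M.Normal] (hM : IsMinimalNormal M)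
    {T : Type*} [Group T] [Nontrivial T] {π : M →* T} (hπ : Function.Surjective π) {x : M}
    (hx : ∀ g : G, conjHom π g x = 1) : x = 1 := by
  -- The intersection of the kernels is normal in `G`, so by minimality it is trivial or `M`; it is
  -- not `M` because `π` is onto a nontrivial group.
  let K : Subgroup G := (⨅ g : G, (conjHom π g).ker).map M.subtype
  have memK : ∀ y : M, (y : G) ∈ K ↔ ∀ g, conjHom π g y = 1 := by
    intro y
    simp [K, Subgroup.mem_iInf, MonoidHom.mem_ker]
  have hKM : K ≤ M := by
    rintro _ ⟨y, -, rfl⟩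
    exact y.2
  have hK : K.Normal := by
    refine ⟨fun y hy h => ?_⟩
    obtain ⟨y, rfl⟩ : ∃ z : M, (z : G) = y := ⟨⟨y, hKM hy⟩, rfl⟩
    have e : h * (y : G) * h⁻¹ = (MulAut.conjNormal h y : M) := by simp
    rw [e, memK]
    intro g
    have := (memK y).1 hy (g * h)
    simpa using this
  rcases hM.2.2 K hK hKM with h | h
  · have : (x : G) ∈ K := (memK x).2 hx
    rw [h, Subgroup.mem_bot] at this
    exact Subtype.ext this
  · obtain ⟨t, ht⟩ := exists_ne (1 : T)
    obtain ⟨y, rfl⟩ := hπ t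
    have := (memK y).1 (by rw [h]; exact y.2) 1
    exact absurd (by simpa using this) ht

theorem exists_surjective_of_isMinimalNormal {T : Type*} [Group T] (hT : IsSocleFactor G T)
    {M : Subgroup G} (hM : IsMinimalNormal M) : ∃ π : M →* T, Function.Surjective π := by
  obtain ⟨hs, l, -, ⟨e⟩⟩ := hT
  have hle : M ≤ socle G := le_sSup hM
  have : M.Normal := hM.1
  have : (M.subgroupOf (socle G)).Normal := inferInstance
  obtain ⟨i, hi⟩ := exists_surjective_eval e (M.subgroupOf (socle G)) (by
    rw [Ne, Subgroup.subgroupOf_eq_bot]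
    exact fun h => hM.2.1 (by simpa [hle] using h.eq_bot_of_le hle))
  exact ⟨(((Pi.evalMonoidHom (fun _ : Fin l => T) i).comp e.toMonoidHom).comp
      (M.subgroupOf (socle G)).subtype).comp (Subgroup.subgroupOfEquivOfLe hle).symm.toMonoidHom,
    hi.comp (Subgroup.subgroupOfEquivOfLe hle).symm.surjective⟩

theorem IsSocleFactor.nonempty_mulEquiv {T T' : Type*} [Group T] [Group T']
    (hT : IsSocleFactor G T) (hT' : IsSocleFactor G T') : Nonempty (T' ≃* T) := by
  obtain ⟨hs, l, hl, ⟨e⟩⟩ := hT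
  obtain ⟨hs', l', -, ⟨e'⟩⟩ := hT'
  exact nonempty_mulEquiv_of_surjective_pi
    ((Pi.evalMonoidHom (fun _ : Fin l => T) ⟨0, hl⟩).comp (e'.symm.trans e).toMonoidHom)
    ((Function.surjective_eval _).comp (e'.symm.trans e).surjective)

end MinimalNormal

/-! ### Counting lemmas -/

section Counting

/-- The set `s` lies in a single left coset of `K`. -/
theorem ncard_image_le_of_inv_mul_mem {A T : Type*} [Group A] [Group T] (f : A →* T)
    {K : Subgroup A} [Finite (K.map f)] {s : Set A} (hs : ∀ a ∈ s, ∀ b ∈ s, a⁻¹ * b ∈ K) :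
    (f '' s).ncard ≤ Nat.card (K.map f) := by
  rcases s.eq_empty_or_nonempty with rfl | ⟨a, ha⟩
  · simp
  · refine Nat.card_le_card_of_injective
      (fun y : f '' s => (⟨(f a)⁻¹ * y, ?_⟩ : K.map f)) fun x y hxy => ?_
    · obtain ⟨_, b, hb, rfl⟩ := y
      exact ⟨a⁻¹ * b, hs a ha b hb, by simp⟩
    · exact Subtype.ext (mul_left_cancel (congrArg Subtype.val hxy))

theorem ncard_le_of_subset_biUnion {α ι : Type*} [Finite α] [Finite ι] {s : Set α} {S : Set ι}
    {t : ι → Set α} {B : ℕ} (hs : ∀ a ∈ s, ∃ i ∈ S, a ∈ t i) (ht : ∀ i ∈ S, (t i).ncard ≤ B) :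
    s.ncard ≤ S.ncard * B := by
  classical
  have := Fintype.ofFinite ι
  have h1 : s ⊆ ⋃ i ∈ S.toFinset, t i := fun a ha => by
    obtain ⟨i, hi, h⟩ := hs a ha
    exact Set.mem_biUnion (by simpa using hi) h
  refine (Set.ncard_le_ncard h1).trans ((Finset.set_ncard_biUnion_le _ _).trans ?_)
  rw [Set.ncard_eq_toFinset_card', ← smul_eq_mul]
  exact Finset.sum_le_card_nsmul _ _ _ fun i hi => ht i (by simpa using hi)

theorem ncard_range_le_of_factors {ι α β : Type*} [Finite β] (F : ι → α) (Φ : ι → β)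
    (h : ∀ i j, Φ i = Φ j → F i = F j) : (Set.range F).ncard ≤ Nat.card β := by
  refine Nat.card_le_card_of_injective (fun x : Set.range F => Φ x.2.choose) fun x y hxy => ?_
  exact Subtype.ext (x.2.choose_spec.symm.trans ((h _ _ hxy).trans y.2.choose_spec))

end Counting

/-! ### Normal subgroups with two orbits on the vertices of a graph -/

section TwoOrbits

variable {V G : Type*} [Group G] [MulAction G V]

/-- `G` acts vertex-transitively on the connected graph `Γ` and `M` has exactly two orbits. -/
structure IsTwoOrbitAction (Γ : SimpleGraph V) (M : Subgroup G) : Prop where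
  connected : Γ.Connected
  smul_adj : ∀ (g : G) {v w : V}, Γ.Adj v w → Γ.Adj (g • v) (g • w)
  transitive : ∀ v w : V, ∃ g : G, g • v = w
  cover : ∀ {v w : V}, w ∉ MulAction.orbit M v →
    ∀ z, z ∈ MulAction.orbit M v ∨ z ∈ MulAction.orbit M w
  intransitive : ∃ v w : V, w ∉ MulAction.orbit M v

/-- An edge joining two different orbits of `M`. -/
def IsCrossing (Γ : SimpleGraph V) (M : Subgroup G) (v w : V) : Prop :=
  Γ.Adj v w ∧ w ∉ MulAction.orbit M v

/-- The pointwise stabiliser in `M` of a vertex and all its neighbours. -/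
def ballStabilizer (Γ : SimpleGraph V) (M : Subgroup G) (v : V) : Subgroup M where
  carrier := {a | a • v = v ∧ ∀ w, Γ.Adj v w → a • w = w}
  one_mem' := by simp
  mul_mem' := by
    rintro a b ⟨ha, ha'⟩ ⟨hb, hb'⟩
    exact ⟨by rw [mul_smul, hb, ha], fun w hw => by rw [mul_smul, hb' w hw, ha' w hw]⟩
  inv_mem' := by
    rintro a ⟨ha, ha'⟩
    exact ⟨inv_smul_eq_iff.2 ha.symm, fun w hw => inv_smul_eq_iff.2 (ha' w hw).symm⟩

theorem ballStabilizer_le {Γ : SimpleGraph V} {M : Subgroup G} {v : V} :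
    ballStabilizer Γ M v ≤ MulAction.stabilizer M v := fun _ ha => ha.1

theorem ballStabilizer_le_of_adj {Γ : SimpleGraph V} {M : Subgroup G} {v w : V}
    (h : Γ.Adj v w) : ballStabilizer Γ M v ≤ MulAction.stabilizer M w := fun _ ha => ha.2 w h

/-- In a connected graph a nonempty set of vertices closed under adjacency contains every vertex. -/
theorem SimpleGraph.Connected.mem_of_closed {Γ : SimpleGraph V} (hΓ : Γ.Connected) {S : Set V}
    {v : V} (hv : v ∈ S) (hS : ∀ x ∈ S, ∀ y, Γ.Adj x y → y ∈ S) (w : V) : w ∈ S := by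
  by_contra hw
  obtain ⟨p⟩ := hΓ.preconnected v w
  obtain ⟨d, -, h1, h2⟩ := p.exists_boundary_dart S hv hw
  exact h2 (hS _ h1 _ d.adj)

variable {Γ : SimpleGraph V} {M : Subgroup G}

theorem IsCrossing.symm {v w : V} (h : IsCrossing Γ M v w) : IsCrossing Γ M w v :=
  ⟨h.1.symm, fun h' => h.2 (MulAction.mem_orbit_symm.1 h')⟩

namespace IsTwoOrbitAction

variable (h : IsTwoOrbitAction Γ M)
include h

theorem smul_adj_iff (g : G) {v w : V} : Γ.Adj (g • v) (g • w) ↔ Γ.Adj v w :=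
  ⟨fun hm => by simpa using h.smul_adj g⁻¹ hm, h.smul_adj g⟩

theorem exists_isCrossing : ∃ v w, IsCrossing Γ M v w := by
  by_contra! hcon
  obtain ⟨v, w, hw⟩ := h.intransitive
  refine hw (h.connected.mem_of_closed (MulAction.mem_orbit_self v) (fun x hx y hxy => ?_) w)
  by_contra hy
  refine hcon x y ⟨hxy, fun hm => hy ?_⟩
  rwa [← MulAction.orbit_eq_iff.2 hx]

theorem mem_orbit_of_isCrossing {v w : V} (hvw : IsCrossing Γ M v w) (z : V) :
    z ∈ MulAction.orbit M v ∨ z ∈ MulAction.orbit M w := h.cover hvw.2 z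

end IsTwoOrbitAction

variable [M.Normal]

theorem smul_smul_normal (g : G) (a : M) (v : V) :
    g • a • v = (MulAut.conjNormal g a : M) • g • v := by
  rw [Subgroup.smul_def, Subgroup.smul_def, MulAut.conjNormal_apply, smul_smul, smul_smul]
  simp

theorem smul_mem_orbit_smul_iff (g : G) (v w : V) :
    g • w ∈ MulAction.orbit M (g • v) ↔ w ∈ MulAction.orbit M v := by
  have key : ∀ (g : G) (v w : V), w ∈ MulAction.orbit M v → g • w ∈ MulAction.orbit M (g • v) := by
    rintro g v _ ⟨a, rfl⟩
    exact ⟨MulAut.conjNormal g a, (smul_smul_normal g a v).symm⟩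
  exact ⟨fun h => by simpa using key g⁻¹ _ _ h, key g v w⟩

/-- A family of subgroups of `M` indexed by vertices and compatible with conjugation. -/
def IsEquivariant (H : V → Subgroup M) : Prop :=
  ∀ (g : G) (v : V) (a : M), a ∈ H v → MulAut.conjNormal g a ∈ H (g • v)

theorem isEquivariant_stabilizer :
    IsEquivariant (fun v : V => MulAction.stabilizer M v) := fun g v a ha => by
  simp only [MulAction.mem_stabilizer_iff] at ha ⊢
  rw [← smul_smul_normal, ha]

variable {T : Type*} [Group T]

/-- Trades a conjugate of `π` for a translate of the vertex; this is how one epimorphism controls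
all its conjugates. -/
theorem IsEquivariant.map_conjHom {H : V → Subgroup M} (hH : IsEquivariant H) (π : M →* T) (g : G)
    (v : V) : (H v).map (conjHom π g) = (H (g • v)).map π := by
  ext t
  constructor
  · rintro ⟨a, ha, rfl⟩
    exact ⟨_, hH g v a ha, rfl⟩
  · rintro ⟨a, ha, rfl⟩
    refine ⟨MulAut.conjNormal g⁻¹ a, ?_, by simp⟩
    have := hH g⁻¹ _ a ha
    rwa [inv_smul_smul] at this

theorem IsEquivariant.map_smul {H : V → Subgroup M} (hH : IsEquivariant H) (π : M →* T) (a : M)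
    (v : V) : (H (a • v)).map π = ((H v).map π).map (MulAut.conj (π a)).toMonoidHom := by
  rw [Subgroup.smul_def, ← hH.map_conjHom, Subgroup.map_map]
  congr 1
  ext b
  simp [conjNormal_coe_apply]

theorem IsEquivariant.card_map_eq_of_mem_orbit {H : V → Subgroup M} (hH : IsEquivariant H)
    (π : M →* T) {v w : V} (h : w ∈ MulAction.orbit M v) :
    Nat.card ((H w).map π) = Nat.card ((H v).map π) := by
  obtain ⟨a, rfl⟩ := h
  rw [hH.map_smul]
  exact Subgroup.card_map_of_injective (MulAut.conj (π a)).injective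

theorem IsEquivariant.card_eq {H : V → Subgroup M} (hH : IsEquivariant H) (g : G) (v : V) :
    Nat.card (H (g • v)) = Nat.card (H v) := by
  have := hH.map_conjHom (MonoidHom.id M) g v
  rw [Subgroup.map_id] at this
  rw [← this]
  exact Subgroup.card_map_of_injective (MulAut.conjNormal g : MulAut M).injective

theorem IsEquivariant.map_eq_bot_of_mem_orbit {H : V → Subgroup M} (hH : IsEquivariant H)
    (π : M →* T) {v w : V} (h : w ∈ MulAction.orbit M v) (hv : (H v).map π = ⊥) :
    (H w).map π = ⊥ := by
  obtain ⟨a, rfl⟩ := h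
  rw [hH.map_smul, hv, Subgroup.map_bot]

theorem IsEquivariant.map_eq_top_of_mem_orbit {H : V → Subgroup M} (hH : IsEquivariant H)
    (π : M →* T) {v w : V} (h : w ∈ MulAction.orbit M v) (hv : (H v).map π = ⊤) :
    (H w).map π = ⊤ := by
  obtain ⟨a, rfl⟩ := h
  rw [hH.map_smul, hv]
  exact Subgroup.map_top_of_surjective _ (MulAut.conj (π a)).surjective

namespace IsTwoOrbitAction

variable (h : IsTwoOrbitAction Γ M)
include h

theorem isCrossing_smul (g : G) {v w : V} (hvw : IsCrossing Γ M v w) :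
    IsCrossing Γ M (g • v) (g • w) :=
  ⟨h.smul_adj g hvw.1, fun hm => hvw.2 ((smul_mem_orbit_smul_iff g v w).1 hm)⟩

theorem isEquivariant_ballStabilizer : IsEquivariant (ballStabilizer Γ M) := by
  rintro g v a ⟨ha, ha'⟩
  refine ⟨by rw [← smul_smul_normal, ha], fun w hw => ?_⟩
  have := ha' (g⁻¹ • w) (by simpa using h.smul_adj g⁻¹ hw)
  have h2 := smul_smul_normal g a (g⁻¹ • w)
  rw [this, smul_inv_smul] at h2
  exact h2.symm

end IsTwoOrbitAction
end TwoOrbits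

/-! ### Bounds for vertex stabilisers -/

/-- The elements of `H` are sorted by the image of `w`; those with a common image lie in one coset
of the stabiliser. -/
theorem card_map_le_mul_card_map_inf_stabilizer {B V T : Type*} [Group B] [Finite B]
    [MulAction B V] [Finite V] [Group T] [Finite T] (f : B →* T) (H : Subgroup B) (w : V)
    {S : Set V} (hS : ∀ b ∈ H, b • w ∈ S) :
    Nat.card (H.map f) ≤ S.ncard * Nat.card ((H ⊓ MulAction.stabilizer B w).map f) := by
  have : Nat.card (H.map f) = (f '' (H : Set B)).ncard := rfl
  rw [this]
  refine ncard_le_of_subset_biUnion (t := fun β => f '' {b | b ∈ H ∧ b • w = β}) ?_ ?_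
  · rintro _ ⟨b, hb, rfl⟩
    exact ⟨b • w, hS b hb, b, ⟨hb, rfl⟩, rfl⟩
  · intro β _
    refine ncard_image_le_of_inv_mul_mem f ?_
    rintro a ⟨ha, ha'⟩ b ⟨hb, hb'⟩
    refine ⟨H.mul_mem (H.inv_mem ha) hb, ?_⟩
    change (a⁻¹ * b) • w = w
    rw [mul_smul, hb', ← ha', inv_smul_smul]

theorem card_le_mul_card_inf_stabilizer {B V : Type*} [Group B] [Finite B]
    [MulAction B V] [Finite V] (H : Subgroup B) (w : V) {S : Set V} (hS : ∀ b ∈ H, b • w ∈ S) :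
    Nat.card H ≤ S.ncard * Nat.card (H ⊓ MulAction.stabilizer B w : Subgroup B) := by
  simpa only [Subgroup.map_id] using
    card_map_le_mul_card_map_inf_stabilizer (MonoidHom.id B) H w hS

section TwoOrbits

variable {V G : Type*} [Group G] [MulAction G V]

/-- The elements of `M` that move `v` or `w` into `S`. -/
def movingSet (M : Subgroup G) (v w : V) (S : Set V) : Set M := {n | n • v ∈ S ∨ n • w ∈ S}

variable {Γ : SimpleGraph V} {M : Subgroup G} {T : Type*} [Group T]

/-- As `v` and `w` lie in different orbits, each `β` in `S` is reachable from at most one of them,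
by elements in a single coset of `M_v` or `M_w`. -/
theorem ncard_image_movingSet_le [Finite V] [Finite T] (π : M →* T) {v w : V}
    (hvw : w ∉ MulAction.orbit M v) {B : ℕ}
    (hv : Nat.card ((MulAction.stabilizer M v).map π) ≤ B)
    (hw : Nat.card ((MulAction.stabilizer M w).map π) ≤ B) (S : Set V) :
    (π '' movingSet M v w S).ncard ≤ S.ncard * B := by
  refine ncard_le_of_subset_biUnion (t := fun β => π '' {n : M | n • v = β ∨ n • w = β}) ?_ ?_
  · rintro _ ⟨n, hn | hn, rfl⟩
    · exact ⟨_, hn, n, Or.inl rfl, rfl⟩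
    · exact ⟨_, hn, n, Or.inr rfl, rfl⟩
  · intro β _
    by_cases hβ : β ∈ MulAction.orbit M v
    · refine (ncard_image_le_of_inv_mul_mem π fun a ha b hb => ?_).trans hv
      have key : ∀ n : M, n • v = β ∨ n • w = β → n • v = β := by
        rintro n (hn | hn)
        · exact hn
        · refine absurd ?_ hvw
          obtain ⟨m, hm⟩ := hβ
          exact ⟨n⁻¹ * m, by simp only [mul_smul, inv_smul_eq_iff]; exact hm.trans hn.symm⟩
      rw [MulAction.mem_stabilizer_iff, mul_smul, key b hb, ← key a ha, inv_smul_smul]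
    · refine (ncard_image_le_of_inv_mul_mem π fun a ha b hb => ?_).trans hw
      have key : ∀ n : M, n • v = β ∨ n • w = β → n • w = β := by
        rintro n (hn | hn)
        · exact absurd ⟨n, hn⟩ hβ
        · exact hn
      rw [MulAction.mem_stabilizer_iff, mul_smul, key b hb, ← key a ha, inv_smul_smul]

namespace IsTwoOrbitAction

variable (h : IsTwoOrbitAction Γ M)
include h

/-- The vertices reached from `v` and `w` by `H` are closed under adjacency: pull an edge back to
`v` or `w`, apply the hypothesis there and push forward. -/
theorem exists_smul_eq {v w : V} {H : Subgroup M}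
    (hv : ∀ β, Γ.Adj v β → ∃ n ∈ H, n • v = β ∨ n • w = β)
    (hw : ∀ β, Γ.Adj w β → ∃ n ∈ H, n • v = β ∨ n • w = β) (z : V) :
    ∃ n ∈ H, n • v = z ∨ n • w = z := by
  refine h.connected.mem_of_closed (S := {z | ∃ n ∈ H, n • v = z ∨ n • w = z})
    ⟨1, H.one_mem, Or.inl (one_smul _ v)⟩ ?_ z
  rintro x ⟨n, hn, hx⟩ y hxy
  have hadj : Γ.Adj (n⁻¹ • x) (n⁻¹ • y) := h.smul_adj ((n⁻¹ : M) : G) hxy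
  have key : ∃ m ∈ H, m • v = n⁻¹ • y ∨ m • w = n⁻¹ • y := by
    rcases hx with rfl | rfl
    · exact hv _ (by simpa using hadj)
    · exact hw _ (by simpa using hadj)
  obtain ⟨m, hm, hy⟩ := key
  exact ⟨n * m, H.mul_mem hn hm, hy.imp (fun e => by rw [mul_smul, e, smul_inv_smul])
    (fun e => by rw [mul_smul, e, smul_inv_smul])⟩

variable [M.Normal]

theorem card_stabilizer_eq (v w : V) :
    Nat.card (MulAction.stabilizer M w) = Nat.card (MulAction.stabilizer M v) := by
  obtain ⟨g, rfl⟩ := h.transitive v w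
  exact isEquivariant_stabilizer.card_eq g v

/-- The elements centralised by `g` carry `v` and `w` to every vertex, so `g` fixes every vertex. -/
theorem eq_one_of_smul_eq [FaithfulSMul G V] {v w : V} (hvw : IsCrossing Γ M v w) {g : G}
    (hv : g • v = v) (hw : g • w = w)
    (hg : ∀ n ∈ movingSet M v w (Γ.neighborSet v ∪ Γ.neighborSet w),
      MulAut.conjNormal g n = n) : g = 1 := by
  let H : Subgroup M := Subgroup.closure (movingSet M v w (Γ.neighborSet v ∪ Γ.neighborSet w))
  have hH : ∀ n ∈ H, MulAut.conjNormal g n = n := by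
    intro n hn
    induction hn using Subgroup.closure_induction with
    | mem n hn => exact hg n hn
    | one => simp
    | mul a b _ _ ha hb => rw [map_mul, ha, hb]
    | inv a _ ha => rw [map_inv, ha]
  have hex : ∀ β, Γ.Adj v β ∨ Γ.Adj w β → ∃ n ∈ H, n • v = β ∨ n • w = β := by
    intro β hβ
    have hβ' : β ∈ Γ.neighborSet v ∪ Γ.neighborSet w := hβ
    rcases h.mem_orbit_of_isCrossing hvw β with ⟨n, rfl⟩ | ⟨n, rfl⟩
    · exact ⟨n, Subgroup.subset_closure (Or.inl hβ'), Or.inl rfl⟩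
    · exact ⟨n, Subgroup.subset_closure (Or.inr hβ'), Or.inr rfl⟩
  refine FaithfulSMul.eq_of_smul_eq_smul (α := V) fun z => ?_
  rw [one_smul]
  obtain ⟨n, hn, rfl | rfl⟩ := h.exists_smul_eq (fun β hβ => hex β (Or.inl hβ))
    (fun β hβ => hex β (Or.inr hβ)) z
  · rw [smul_smul_normal, hH n hn, hv]
  · rw [smul_smul_normal, hH n hn, hw]

/-- Fixing a neighbour across the orbits costs a factor `d`. The stabiliser of the resulting edge
acts by conjugation on the moving set of its neighbourhood, which has at most `2 * d * |M_v|`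
elements, and faithfully by `eq_one_of_smul_eq`. -/
theorem card_stabilizer_le [Finite V] [Finite G] [FaithfulSMul G V] {d : ℕ}
    (hd : ∀ x, (Γ.neighborSet x).ncard ≤ d) (v x : V) :
    Nat.card (MulAction.stabilizer G x) ≤
      d * (2 * d * Nat.card (MulAction.stabilizer M v))! := by
  obtain ⟨x', y', hxy'⟩ := h.exists_isCrossing
  obtain ⟨g, rfl⟩ := h.transitive x' x
  obtain ⟨y, hxy⟩ : ∃ y, IsCrossing Γ M (g • x') y := ⟨_, h.isCrossing_smul g hxy'⟩
  generalize g • x' = x at hxy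
  rw [h.card_stabilizer_eq x v]
  refine (card_le_mul_card_inf_stabilizer _ y (S := Γ.neighborSet x) ?_).trans
    (Nat.mul_le_mul (hd x) ?_)
  · intro b hb
    have := h.smul_adj b hxy.1
    rwa [MulAction.mem_stabilizer_iff.1 hb] at this
  set X := movingSet M x y (Γ.neighborSet x ∪ Γ.neighborSet y) with hX
  have hXcard : Nat.card X ≤ 2 * d * Nat.card (MulAction.stabilizer M x) := by
    have := ncard_image_movingSet_le (MonoidHom.id M) hxy.2
      (B := Nat.card (MulAction.stabilizer M x)) (by rw [Subgroup.map_id])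
      (by rw [Subgroup.map_id, h.card_stabilizer_eq x y]) (Γ.neighborSet x ∪ Γ.neighborSet y)
    simp only [MonoidHom.coe_id, Set.image_id] at this
    refine this.trans (Nat.mul_le_mul_right _ ((Set.ncard_union_le _ _).trans ?_))
    linarith [hd x, hd y]
  refine le_trans ?_ (Nat.factorial_le hXcard)
  rw [← Nat.card_perm]
  have hpres : ∀ g : G, g ∈ MulAction.stabilizer G x ⊓ MulAction.stabilizer G y →
      ∀ n : M, n ∈ X ↔ (MulAut.conjNormal g : MulAut M) n ∈ X := by
    rintro g ⟨hgx, hgy⟩ n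
    have hgx' : g • x = x := hgx
    have hgy' : g • y = y := hgy
    have e1 : (MulAut.conjNormal g n : M) • x = g • n • x := by
      rw [smul_smul_normal, hgx']
    have e2 : (MulAut.conjNormal g n : M) • y = g • n • y := by
      rw [smul_smul_normal, hgy']
    have e3 : ∀ z, g • z ∈ Γ.neighborSet x ∪ Γ.neighborSet y ↔
        z ∈ Γ.neighborSet x ∪ Γ.neighborSet y := by
      intro z
      simp only [Set.mem_union, SimpleGraph.mem_neighborSet]
      conv_lhs => rw [← hgx', ← hgy']
      rw [h.smul_adj_iff, h.smul_adj_iff]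
    simp only [hX, movingSet, Set.mem_ofPred_eq, e1, e2, e3]
  refine Nat.card_le_card_of_injective
    (fun g : (MulAction.stabilizer G x ⊓ MulAction.stabilizer G y : Subgroup G) =>
      (Equiv.subtypeEquiv (MulAut.conjNormal (g : G) : MulAut M).toEquiv (hpres g g.2) :
        Equiv.Perm X)) ?_
  intro g g' hgg
  have hmem := mul_mem (inv_mem g'.2) g.2
  have h1 := h.eq_one_of_smul_eq hxy (g := (g' : G)⁻¹ * g) hmem.1 hmem.2 (by
    intro n hn
    have := congrArg Subtype.val (DFunLike.congr_fun hgg (⟨n, hn⟩ : X))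
    have h2 : (MulAut.conjNormal (g : G) : MulAut M) n = MulAut.conjNormal (g' : G) n := this
    rw [map_mul, MulAut.mul_apply, h2, map_inv, MulAut.inv_apply_self])
  exact Subtype.ext (inv_mul_eq_one.1 h1).symm

end IsTwoOrbitAction
end TwoOrbits

/-! ### Absolute bounds in the degenerate cases -/

section TwoOrbits

variable {V G : Type*} [Group G] [MulAction G V]
variable {Γ : SimpleGraph V} {M : Subgroup G} {T : Type*} [Group T]

namespace IsTwoOrbitAction

variable (h : IsTwoOrbitAction Γ M)
include h

/-- In valency at most two an automorphism that fixes both ends of an edge is trivial. -/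
theorem eq_one_of_valency_le_two [Finite V] [FaithfulSMul G V]
    (hd : ∀ x, (Γ.neighborSet x).ncard ≤ 2) {v w : V} (hvw : Γ.Adj v w) {g : G}
    (hv : g • v = v) (hw : g • w = w) : g = 1 := by
  refine FaithfulSMul.eq_of_smul_eq_smul (α := V) fun z => ?_
  rw [one_smul]
  -- The fixed vertices with a fixed neighbour are closed under adjacency: otherwise `t`, `g • t`
  -- and `u'` would be three neighbours of `u`.
  refine (h.connected.mem_of_closed
    (S := {u | g • u = u ∧ ∃ u', Γ.Adj u u' ∧ g • u' = u'}) ⟨hv, w, hvw, hw⟩ ?_ z).1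
  rintro u ⟨hu, u', huu', hu'⟩ t ht
  refine ⟨?_, u, ht.symm, hu⟩
  by_contra hgt
  have hne : t ≠ u' := by
    rintro rfl
    exact hgt hu'
  have hne' : g • t ≠ u' := by
    intro e
    rw [← hu'] at e
    exact hne (MulAction.injective g e)
  have hgu : Γ.Adj u (g • t) := by
    have := h.smul_adj g ht
    rwa [hu] at this
  have h3 : ({t, g • t, u'} : Set V).ncard = 3 :=
    Set.ncard_eq_three.2 ⟨t, g • t, u', fun e => hgt e.symm, hne, hne', rfl⟩
  have hsub : ({t, g • t, u'} : Set V) ⊆ Γ.neighborSet u := by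
    rintro _ (rfl | rfl | rfl)
    exacts [ht, hgu, huu']
  have := Set.ncard_le_ncard hsub
  have := hd u
  omega

theorem card_stabilizer_le_of_valency_le_two [Finite V] [Finite G] [FaithfulSMul G V] {d : ℕ}
    (hd : ∀ x, (Γ.neighborSet x).ncard ≤ d) (hd2 : d ≤ 2) (x : V) :
    Nat.card (MulAction.stabilizer G x) ≤ d := by
  obtain ⟨x', y', hxy'⟩ := h.exists_isCrossing
  obtain ⟨g, rfl⟩ := h.transitive x' x
  have hxy := h.smul_adj g hxy'.1
  refine (card_le_mul_card_inf_stabilizer _ (g • y') (S := Γ.neighborSet (g • x')) ?_).trans ?_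
  · intro b hb
    have := h.smul_adj b hxy
    rwa [MulAction.mem_stabilizer_iff.1 hb] at this
  · have : MulAction.stabilizer G (g • x') ⊓ MulAction.stabilizer G (g • y') = ⊥ :=
      (Subgroup.eq_bot_iff_forall _).2 fun b hb =>
        h.eq_one_of_valency_le_two (fun x => (hd x).trans hd2) hxy hb.1 hb.2
    rw [this, Subgroup.card_bot, mul_one]
    exact hd _

theorem card_stabilizer_normal_le [Finite V] [Finite G] {d : ℕ}
    (hd : ∀ x, (Γ.neighborSet x).ncard ≤ d) {v w : V} (hvw : Γ.Adj v w) :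
    Nat.card (MulAction.stabilizer M v) ≤ d *
      Nat.card (MulAction.stabilizer M v ⊓ MulAction.stabilizer M w : Subgroup M) := by
  refine (card_le_mul_card_inf_stabilizer _ w (S := Γ.neighborSet v) ?_).trans
    (Nat.mul_le_mul_right _ (hd v))
  intro b hb
  have := h.smul_adj (b : G) hvw
  rwa [show (b : G) • v = v from hb] at this

theorem card_map_stabilizer_le [Finite V] [Finite G] [Finite T] (π : M →* T) {d : ℕ}
    (hd : ∀ x, (Γ.neighborSet x).ncard ≤ d) {v w : V} (hvw : Γ.Adj v w) :
    Nat.card ((MulAction.stabilizer M v).map π) ≤ d *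
      Nat.card ((MulAction.stabilizer M v ⊓ MulAction.stabilizer M w : Subgroup M).map π) := by
  refine (card_map_le_mul_card_map_inf_stabilizer π _ w (S := Γ.neighborSet v) ?_).trans
    (Nat.mul_le_mul_right _ (hd v))
  intro b hb
  have := h.smul_adj (b : G) hvw
  rwa [show (b : G) • v = v from hb] at this

/-- The edge stabiliser acts on the two neighbourhoods, and the kernel of this action is the
intersection of the ball stabilisers. -/
theorem card_inf_stabilizer_le [Finite V] [Finite G] {d : ℕ}
    (hd : ∀ x, (Γ.neighborSet x).ncard ≤ d) {v w : V}
    (hb : ballStabilizer Γ M v ⊓ ballStabilizer Γ M w = ⊥) :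
    Nat.card (MulAction.stabilizer M v ⊓ MulAction.stabilizer M w : Subgroup M) ≤ (d !) ^ 2 := by
  have hpres : ∀ (x : V) (a : M), a • x = x →
      ∀ z, z ∈ Γ.neighborSet x ↔ a • z ∈ Γ.neighborSet x := by
    intro x a ha z
    simp only [SimpleGraph.mem_neighborSet]
    constructor
    · intro hz
      have := h.smul_adj (a : G) hz
      rwa [show (a : G) • x = x from ha] at this
    · intro hz
      have := h.smul_adj (a : G)⁻¹ hz
      rwa [show (a : G)⁻¹ • x = x from inv_smul_eq_iff.2 (show x = (a : G) • x from ha.symm),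
        show (a : G)⁻¹ • a • z = z from inv_smul_smul (a : G) z] at this
  let E : ∀ x : V, ∀ a : M, a • x = x → Equiv.Perm (Γ.neighborSet x) := fun x a ha =>
    Equiv.subtypeEquiv (MulAction.toPerm a) (hpres x a ha)
  have hinj : Function.Injective
      (fun a : (MulAction.stabilizer M v ⊓ MulAction.stabilizer M w : Subgroup M) =>
        (E v a a.2.1, E w a a.2.2)) := by
    intro a b hab
    have h1 : ∀ z, Γ.Adj v z → (a : M) • z = (b : M) • z := fun z hz =>
      congrArg (fun p => ((p.1 ⟨z, hz⟩ : Γ.neighborSet v) : V)) hab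
    have h2 : ∀ z, Γ.Adj w z → (a : M) • z = (b : M) • z := fun z hz =>
      congrArg (fun p => ((p.2 ⟨z, hz⟩ : Γ.neighborSet w) : V)) hab
    have hm := mul_mem (inv_mem b.2) a.2
    have : (b : M)⁻¹ * a ∈ ballStabilizer Γ M v ⊓ ballStabilizer Γ M w :=
      ⟨⟨hm.1, fun z hz => by rw [mul_smul, h1 z hz, inv_smul_smul]⟩,
        ⟨hm.2, fun z hz => by rw [mul_smul, h2 z hz, inv_smul_smul]⟩⟩
    rw [hb, Subgroup.mem_bot, inv_mul_eq_one] at this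
    exact Subtype.ext this.symm
  refine (Nat.card_le_card_of_injective _ hinj).trans ?_
  rw [Nat.card_prod, Nat.card_perm, Nat.card_perm, sq]
  exact Nat.mul_le_mul (Nat.factorial_le (hd v)) (Nat.factorial_le (hd w))

variable [M.Normal]

/-- Every `g` carries `v` or `w` into the orbit of `x`, where `π` kills ball stabilisers. So every
conjugate of `π` kills the intersection. -/
theorem inf_ballStabilizer_eq_bot [Nontrivial T] (hM : IsMinimalNormal M) {π : M →* T}
    (hπ : Function.Surjective π) {v w x : V} (hvw : IsCrossing Γ M v w)
    (hx : (ballStabilizer Γ M x).map π = ⊥) :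
    ballStabilizer Γ M v ⊓ ballStabilizer Γ M w = ⊥ := by
  refine (Subgroup.eq_bot_iff_forall _).2 fun a ha => eq_one_of_conjHom_eq_one hM hπ fun g => ?_
  have key : ∀ u : V, a ∈ ballStabilizer Γ M u → g • u ∈ MulAction.orbit M x →
      conjHom π g a = 1 := by
    intro u hu hgu
    have h1 := h.isEquivariant_ballStabilizer.map_eq_bot_of_mem_orbit π hgu hx
    rw [← h.isEquivariant_ballStabilizer.map_conjHom] at h1
    rw [← Subgroup.mem_bot, ← h1]
    exact Subgroup.mem_map_of_mem _ hu
  rcases h.mem_orbit_of_isCrossing (h.isCrossing_smul g hvw) x with hm | hm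
  · exact key v ha.1 (MulAction.mem_orbit_symm.1 hm)
  · exact key w ha.2 (MulAction.mem_orbit_symm.1 hm)

/-- The edge stabiliser is trivial. If `T` is abelian then so is `M`, and `eq_one_of_smul_eq`
applies. Otherwise ball stabilisers are normal in vertex stabilisers with nontrivial, hence full,
images in `T`; by `le_of_map_eq_top` the two coincide, and connectedness makes them act trivially.
-/
theorem card_stabilizer_normal_le_of_map_eq_top [Finite V] [Finite G] [FaithfulSMul G V]
    [IsSimpleGroup T] (hM : IsMinimalNormal M) {π : M →* T} (hπ : Function.Surjective π) {d : ℕ}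
    (hd : ∀ x, (Γ.neighborSet x).ncard ≤ d)
    (htop : ∀ x : V, (MulAction.stabilizer M x).map π = ⊤)
    (hball : ∀ x, (ballStabilizer Γ M x).map π ≠ ⊥) {v w : V} (hvw : IsCrossing Γ M v w) :
    Nat.card (MulAction.stabilizer M v) ≤ d := by
  refine (h.card_stabilizer_normal_le hd hvw.1).trans ?_
  suffices hbot : MulAction.stabilizer M v ⊓ MulAction.stabilizer M w = ⊥ by
    rw [hbot, Subgroup.card_bot, mul_one]
  refine (Subgroup.eq_bot_iff_forall _).2 fun a ha => ?_
  by_cases hT : ∀ a b : T, a * b = b * a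
  · have hcomm : ∀ a b : M, a * b = b * a := by
      intro a b
      rw [← mul_inv_eq_one]
      refine eq_one_of_conjHom_eq_one hM hπ fun g => ?_
      rw [map_mul, map_inv, map_mul, map_mul, hT (conjHom π g a), mul_inv_cancel]
    refine Subtype.ext (h.eq_one_of_smul_eq hvw (g := (a : G)) ha.1 ha.2 fun n _ => ?_)
    rw [conjNormal_coe_apply, hcomm, inv_mul_cancel_left]
  · have hle : ∀ x : V, MulAction.stabilizer M x ≤ ballStabilizer Γ M x := by
      intro x
      refine le_of_map_eq_top hT (fun g : G => conjHom π g)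
        (fun y hy => eq_one_of_conjHom_eq_one hM hπ hy) ballStabilizer_le ?_ ?_
      · intro s hs q hq
        have := h.isEquivariant_ballStabilizer (s : G) x q hq
        rwa [conjNormal_coe_apply, show (s : G) • x = x from hs] at this
      · intro g
        rw [h.isEquivariant_ballStabilizer.map_conjHom]
        refine (Subgroup.Normal.eq_bot_or_eq_top ⟨?_⟩).resolve_left (hball _)
        rintro _ ⟨q, hq, rfl⟩ t
        obtain ⟨s, hs, rfl⟩ : t ∈ (MulAction.stabilizer M (g • x)).map π :=
          htop (g • x) ▸ Subgroup.mem_top t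
        refine ⟨s * q * s⁻¹, ?_, by simp⟩
        have := h.isEquivariant_ballStabilizer (s : G) (g • x) q hq
        rwa [conjNormal_coe_apply, show (s : G) • g • x = g • x from hs] at this
    have hfix : ∀ z : V, a • z = z := h.connected.mem_of_closed (S := {z : V | a • z = z}) ha.1
      fun x hx y hxy => (hle x hx).2 y hxy
    exact Subtype.ext (FaithfulSMul.eq_of_smul_eq_smul (α := V) fun z =>
      (hfix z).trans (one_smul G z).symm)

/-- The cases in which vertex stabilisers are bounded absolutely in terms of the valency. -/
theorem card_stabilizer_normal_le_absolute [Finite V] [Finite G] [FaithfulSMul G V]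
    [IsSimpleGroup T] (hM : IsMinimalNormal M) {π : M →* T} (hπ : Function.Surjective π) {d : ℕ}
    (hd : ∀ x, (Γ.neighborSet x).ncard ≤ d)
    (hcase : (∃ x, (ballStabilizer Γ M x).map π = ⊥) ∨
      ∀ x : V, (MulAction.stabilizer M x).map π = ⊤) {v w : V} (hvw : IsCrossing Γ M v w) :
    Nat.card (MulAction.stabilizer M v) ≤ d * (d !) ^ 2 := by
  by_cases hb : ∃ x, (ballStabilizer Γ M x).map π = ⊥
  · obtain ⟨x, hx⟩ := hb
    exact (h.card_stabilizer_normal_le hd hvw.1).trans (Nat.mul_le_mul_left _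
      (h.card_inf_stabilizer_le hd (h.inf_ballStabilizer_eq_bot hM hπ hvw hx)))
  · refine (h.card_stabilizer_normal_le_of_map_eq_top hM hπ hd (hcase.resolve_left hb)
      (not_exists.1 hb) hvw).trans (Nat.le_mul_of_pos_right _ ?_)
    exact pow_pos (Nat.factorial_pos d) 2

end IsTwoOrbitAction
end TwoOrbits

/-! ### Counting the kernels of the conjugates of a simple quotient -/

section TwoOrbits

variable {V G : Type*} [Group G] [MulAction G V]
variable {Γ : SimpleGraph V} {M : Subgroup G} {T : Type*} [Group T]

namespace IsTwoOrbitAction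

variable (h : IsTwoOrbitAction Γ M)
include h

/-- A subgroup of `M` that links the ends of a crossing edge to all their neighbours acts
transitively on each orbit of `M`. -/
theorem exists_smul_eq_smul {v w : V} (hvw : IsCrossing Γ M v w) {H : Subgroup M}
    (hv : ∀ β, Γ.Adj v β → ∃ n ∈ H, n • v = β ∨ n • w = β)
    (hw : ∀ β, Γ.Adj w β → ∃ n ∈ H, n • v = β ∨ n • w = β) {u : V} (hu : u = v ∨ u = w)
    (a : M) : ∃ n ∈ H, n • u = a • u := by
  obtain ⟨n, hn, h'⟩ := h.exists_smul_eq hv hw (a • u)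
  refine ⟨n, hn, ?_⟩
  rcases hu with rfl | rfl <;> rcases h' with h' | h'
  · exact h'
  · refine absurd ⟨n⁻¹ * a, ?_⟩ hvw.2
    simp only [mul_smul, ← h', inv_smul_smul]
  · refine absurd ⟨n⁻¹ * a, ?_⟩ hvw.symm.2
    simp only [mul_smul, ← h', inv_smul_smul]
  · exact h'

variable [M.Normal]

theorem map_ne_top_of_isCrossing {π : M →* T}
    (hne : ∃ x : V, (MulAction.stabilizer M x).map π ≠ ⊤) {v w : V} (hvw : IsCrossing Γ M v w) :
    (MulAction.stabilizer M v).map π ≠ ⊤ ∨ (MulAction.stabilizer M w).map π ≠ ⊤ := by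
  obtain ⟨x, hx⟩ := hne
  refine (h.mem_orbit_of_isCrossing hvw x).imp (fun hm htop => hx ?_) (fun hm htop => hx ?_)
  · exact isEquivariant_stabilizer.map_eq_top_of_mem_orbit π hm htop
  · exact isEquivariant_stabilizer.map_eq_top_of_mem_orbit π hm htop

/-- For each `β` fix an element of `M` carrying `v` or `w` to `β`, and record its value under the
conjugate of `π` by `g`, for `β` next to `v` or `w`. The edge `{v, w}` needs no record, so each end
has at most `d - 1` values, each from a set of size at most `(d - 1) * B`. Suppose `g` and `g'` have
equal records and different kernels. Their equaliser is transitive on each `M`-orbit, so an element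
of `M` with values `t` and `1` can be moved into `M_u` by the equaliser. The quotient of its two new
values is still `t`, whence `π` maps both `M_v'` and `M_w'` onto `T`. -/
theorem ncard_ker_conjHom_le [Finite V] [Finite G] [Finite T] [IsSimpleGroup T] {π : M →* T}
    (hπ : Function.Surjective π) {d B : ℕ} (hd : ∀ x, (Γ.neighborSet x).ncard ≤ d) (hd2 : 2 ≤ d)
    (hB : ∀ x : V, Nat.card ((MulAction.stabilizer M x).map π) ≤ B)
    (hne : ∃ x : V, (MulAction.stabilizer M x).map π ≠ ⊤) {v w : V} (hvw : IsCrossing Γ M v w)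
    (v' w' : V) :
    (Set.range fun g : {g : G // g • v = v' ∧ g • w = w'} => (conjHom π (g : G)).ker).ncard ≤
      ((d - 1) * B) ^ (2 * (d - 1)) := by
  rcases isEmpty_or_nonempty {g : G // g • v = v' ∧ g • w = w'} with hemp | ⟨⟨g₀, hg₀v, hg₀w⟩⟩
  · simp [Set.range_eq_empty]
  have hvw' : IsCrossing Γ M v' w' := by
    rw [← hg₀v, ← hg₀w]
    exact h.isCrossing_smul g₀ hvw
  have hy : ∀ β : V, ∃ n : M, n • v = β ∨ n • w = β := fun β => by
    rcases h.mem_orbit_of_isCrossing hvw β with ⟨n, hn⟩ | ⟨n, hn⟩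
    exacts [⟨n, Or.inl hn⟩, ⟨n, Or.inr hn⟩]
  choose y hy using hy
  let Z₁ : Set T := π '' movingSet M v' w' (Γ.neighborSet v' \ {w'})
  let Z₂ : Set T := π '' movingSet M v' w' (Γ.neighborSet w' \ {v'})
  have hmem : ∀ g : G, g • v = v' → g • w = w' → ∀ (S : Set V) (β : V), g • β ∈ S →
      conjHom π g (y β) ∈ π '' movingSet M v' w' S := by
    intro g hgv hgw S β hβ
    refine ⟨MulAut.conjNormal g (y β), ?_, rfl⟩
    rcases hy β with hn | hn
    · left
      rw [← hgv, ← smul_smul_normal, hn]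
      exact hβ
    · right
      rw [← hgw, ← smul_smul_normal, hn]
      exact hβ
  have hS : ∀ (g : G) (x z x' z' : V), g • x = x' → g • z = z' →
      ∀ β ∈ Γ.neighborSet x \ {z}, g • β ∈ Γ.neighborSet x' \ {z'} := by
    rintro g x z _ _ rfl rfl β ⟨hβ, hβz⟩
    exact ⟨h.smul_adj g hβ, fun e => hβz (MulAction.injective g e)⟩
  let Φ : {g : G // g • v = v' ∧ g • w = w'} →
      ((Γ.neighborSet v \ {w} : Set V) → Z₁) × ((Γ.neighborSet w \ {v} : Set V) → Z₂) := fun g =>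
    (fun β => ⟨conjHom π g (y β), hmem g g.2.1 g.2.2 _ _ (hS g v w _ _ g.2.1 g.2.2 β β.2)⟩,
      fun β => ⟨conjHom π g (y β), hmem g g.2.1 g.2.2 _ _ (hS g w v _ _ g.2.2 g.2.1 β β.2)⟩)
  refine (ncard_range_le_of_factors _ Φ ?_).trans ?_
  · rintro ⟨g, hgv, hgw⟩ ⟨g', hgv', hgw'⟩ hgg
    by_contra hker
    let H : Subgroup M := (conjHom π g).eqLocus (conjHom π g')
    have h1 : ∀ β, Γ.Adj v β → ∃ n ∈ H, n • v = β ∨ n • w = β := by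
      intro β hβ
      by_cases e : β = w
      · exact ⟨1, H.one_mem, Or.inr (by rw [one_smul, e])⟩
      · exact ⟨y β, congrArg Subtype.val (congrFun (congrArg Prod.fst hgg) ⟨β, hβ, e⟩), hy β⟩
    have h2 : ∀ β, Γ.Adj w β → ∃ n ∈ H, n • v = β ∨ n • w = β := by
      intro β hβ
      by_cases e : β = v
      · exact ⟨1, H.one_mem, Or.inl (by rw [one_smul, e])⟩
      · exact ⟨y β, congrArg Subtype.val (congrFun (congrArg Prod.snd hgg) ⟨β, hβ, e⟩), hy β⟩
    have key : ∀ u u' : V, u = v ∨ u = w → g • u = u' → g' • u = u' →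
        (MulAction.stabilizer M u').map π = ⊤ := by
      intro u u' hu hgu hgu'
      refine (Subgroup.eq_top_iff' _).2 fun t => ?_
      obtain ⟨a, hat, ha1⟩ := exists_map_eq_and_map_eq_one (conjHom_surjective hπ g)
        (conjHom_surjective hπ g') hker t
      obtain ⟨n, hn, hna⟩ := h.exists_smul_eq_smul hvw h1 h2 hu a
      have hs : n⁻¹ * a ∈ MulAction.stabilizer M u := by
        rw [MulAction.mem_stabilizer_iff, mul_smul, ← hna, inv_smul_smul]
      have m1 := Subgroup.mem_map_of_mem (conjHom π g) hs
      have m2 := Subgroup.mem_map_of_mem (conjHom π g') hs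
      rw [isEquivariant_stabilizer.map_conjHom, hgu] at m1
      rw [isEquivariant_stabilizer.map_conjHom, hgu'] at m2
      have hn' : conjHom π g n = conjHom π g' n := hn
      have := mul_mem (inv_mem m2) m1
      rwa [map_mul, map_mul, map_inv, map_inv, hat, ha1, hn', mul_one, inv_inv,
        mul_inv_cancel_left] at this
    rcases h.map_ne_top_of_isCrossing hne hvw' with hn | hn
    · exact hn (key v v' (Or.inl rfl) hgv hgv')
    · exact hn (key w w' (Or.inr rfl) hgw hgw')
  · have hBpos : 0 < B := Nat.card_pos.trans_le (hB v)
    have hX : 0 < (d - 1) * B := Nat.mul_pos (by omega) hBpos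
    have hcard : ∀ x z : V, Γ.Adj x z → (Γ.neighborSet x \ {z}).ncard ≤ d - 1 := by
      intro x z hxz
      rw [Set.ncard_sdiff_singleton_of_mem (show z ∈ Γ.neighborSet x from hxz)]
      exact Nat.sub_le_sub_right (hd x) 1
    have hz : ∀ x z : V, Γ.Adj x z →
        (π '' movingSet M v' w' (Γ.neighborSet x \ {z})).ncard ≤ (d - 1) * B := fun x z hxz =>
      (ncard_image_movingSet_le π hvw'.2 (hB v') (hB w') _).trans
        (Nat.mul_le_mul_right _ (hcard x z hxz))
    rw [Nat.card_prod, Nat.card_fun, Nat.card_fun, two_mul, pow_add]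
    exact Nat.mul_le_mul
      ((Nat.pow_le_pow_left (hz v' w' hvw'.1) _).trans
        (Nat.pow_le_pow_right hX (hcard v w hvw.1)))
      ((Nat.pow_le_pow_left (hz w' v' hvw'.1.symm) _).trans
        (Nat.pow_le_pow_right hX (hcard w v hvw.1.symm)))

/-- Modulo `M`, which does not affect kernels, `g` carries `v` to `v` or `w`. This leaves at most `2
* d` possible images of the arc `(v, w)`. -/
theorem ncard_range_ker_conjHom_le [Finite V] [Finite G] [Finite T] [IsSimpleGroup T] {π : M →* T}
    (hπ : Function.Surjective π) {d B : ℕ} (hd : ∀ x, (Γ.neighborSet x).ncard ≤ d) (hd2 : 2 ≤ d)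
    (hB : ∀ x : V, Nat.card ((MulAction.stabilizer M x).map π) ≤ B)
    (hne : ∃ x : V, (MulAction.stabilizer M x).map π ≠ ⊤) :
    (Set.range fun g : G => (conjHom π g).ker).ncard ≤
      2 * d * ((d - 1) * B) ^ (2 * (d - 1)) := by
  obtain ⟨v, w, hvw⟩ := h.exists_isCrossing
  let S : Set (V × V) := (fun β => (v, β)) '' Γ.neighborSet v ∪ (fun β => (w, β)) '' Γ.neighborSet w
  have hS : S.ncard ≤ 2 * d := by
    refine (Set.ncard_union_le _ _).trans ?_
    have h1 := (Set.ncard_image_le (s := Γ.neighborSet v) (f := fun β => (v, β))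
      (Set.toFinite _)).trans (hd v)
    have h2 := (Set.ncard_image_le (s := Γ.neighborSet w) (f := fun β => (w, β))
      (Set.toFinite _)).trans (hd w)
    omega
  refine (ncard_le_of_subset_biUnion (S := S) (t := fun p => Set.range
    fun g : {g : G // g • v = p.1 ∧ g • w = p.2} => (conjHom π (g : G)).ker) ?_ ?_).trans
    (Nat.mul_le_mul_right _ hS)
  · rintro _ ⟨g, rfl⟩
    have key : ∀ a : M, (conjHom π g).ker = (conjHom π (((a⁻¹ : M) : G) * g)).ker := fun a =>
      (ker_conjHom_coe_mul π _ g).symm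
    have hadj : ∀ (a : M) (u : V), a • u = g • v → Γ.Adj u ((((a⁻¹ : M) : G) * g) • w) := by
      intro a u hu
      have := h.smul_adj (((a⁻¹ : M) : G) * g) hvw.1
      rwa [mul_smul, ← hu, show ((a⁻¹ : M) : G) • a • u = u from inv_smul_smul a u] at this
    have hfst : ∀ (a : M) (u : V), a • u = g • v → (((a⁻¹ : M) : G) * g) • v = u := by
      intro a u hu
      rw [mul_smul, ← hu]
      exact inv_smul_smul a u
    rcases h.mem_orbit_of_isCrossing hvw (g • v) with ⟨a, ha⟩ | ⟨a, ha⟩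
    · exact ⟨(v, _), Or.inl ⟨_, hadj a v ha, rfl⟩, ⟨_, hfst a v ha, rfl⟩, (key a).symm⟩
    · exact ⟨(w, _), Or.inr ⟨_, hadj a w ha, rfl⟩, ⟨_, hfst a w ha, rfl⟩, (key a).symm⟩
  · exact fun p _ => h.ncard_ker_conjHom_le hπ hd hd2 hB hne hvw p.1 p.2

/-- The order of a vertex stabiliser in `M` in terms of its projections to the simple factors. -/
theorem card_stabilizer_normal_le_pow [Finite V] [Finite G] [Finite T] [IsSimpleGroup T]
    (hM : IsMinimalNormal M) {π : M →* T}
    (hπ : Function.Surjective π) {d B : ℕ} (hd : ∀ x, (Γ.neighborSet x).ncard ≤ d) (hd2 : 2 ≤ d)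
    (hB : ∀ x : V, Nat.card ((MulAction.stabilizer M x).map π) ≤ B)
    (hne : ∃ x : V, (MulAction.stabilizer M x).map π ≠ ⊤) (v : V) :
    Nat.card (MulAction.stabilizer M v) ≤ B ^ (2 * d * ((d - 1) * B) ^ (2 * (d - 1))) := by
  classical
  have := Fintype.ofFinite (Set.range fun g : G => (conjHom π g).ker)
  have hbot : (⨅ K : Set.range fun g : G => (conjHom π g).ker, (K : Subgroup M)) = ⊥ := by
    refine (Subgroup.eq_bot_iff_forall _).2 fun a ha => eq_one_of_conjHom_eq_one hM hπ fun g => ?_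
    exact Subgroup.mem_iInf.1 ha ⟨_, g, rfl⟩
  -- The order of `M_v` is at most the product of the indices in it of the distinct kernels, each
  -- index being the order of some `π(M_x)`.
  rw [← Subgroup.relIndex_bot_left, ← hbot]
  refine (Subgroup.relIndex_iInf_le _).trans ((Finset.prod_le_pow_card _ _ B ?_).trans ?_)
  · rintro ⟨_, g, rfl⟩ -
    rw [Subgroup.relIndex_ker, isEquivariant_stabilizer.map_conjHom]
    exact hB _
  · refine Nat.pow_le_pow_right (Nat.card_pos.trans_le (hB v)) ?_
    rw [Finset.card_univ, ← Nat.card_eq_fintype_card]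
    exact h.ncard_range_ker_conjHom_le hπ hd hd2 hB hne

end IsTwoOrbitAction
end TwoOrbits

/-! ### Coset graphs -/

section CosetGraph

variable {A : Type u} [Group A]

/-- The graph on the cosets of `J` in which `aJ` is joined to `anJ` for `n ∈ X`. -/
def cosetGraph (J : Subgroup A) (X : Set A) (hX : ∀ n ∈ X, n⁻¹ ∈ X) : SimpleGraph (A ⧸ J) where
  Adj p q := p ≠ q ∧ ∃ a n : A, n ∈ X ∧ p = (a : A ⧸ J) ∧ q = ((a * n : A) : A ⧸ J)
  symm := ⟨by
    rintro p q ⟨hpq, a, n, hn, rfl, rfl⟩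
    exact ⟨hpq.symm, a * n, n⁻¹, hX n hn, rfl, by rw [mul_inv_cancel_right]⟩⟩
  loopless := ⟨fun _ hp => hp.1 rfl⟩

variable {J : Subgroup A} {X : Set A} (hX : ∀ n ∈ X, n⁻¹ ∈ X)

theorem cosetGraph_adj_smul (b : A) {p q : A ⧸ J} (h : (cosetGraph J X hX).Adj p q) :
    (cosetGraph J X hX).Adj (b • p) (b • q) := by
  obtain ⟨hpq, a, n, hn, rfl, rfl⟩ := h
  exact ⟨fun e => hpq (MulAction.injective b e), b * a, n, hn, rfl, by rw [mul_assoc]; rfl⟩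

/-- The action of the group on a coset graph by left multiplication. -/
def cosetGraphHom : A →* (cosetGraph J X hX ≃g cosetGraph J X hX) where
  toFun b :=
    { toEquiv := MulAction.toPerm b
      map_rel_iff' := ⟨fun h => by simpa using cosetGraph_adj_smul hX b⁻¹ h,
        cosetGraph_adj_smul hX b⟩ }
  map_one' := RelIso.ext fun p => one_smul A p
  map_mul' a b := RelIso.ext fun p => mul_smul a b p

/-- A coset graph together with the group induced by left multiplication. -/
def cosetPair [Finite A] (J : Subgroup A) (X : Set A) (hX : ∀ n ∈ X, n⁻¹ ∈ X) : GraphPair.{u} where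
  V := A ⧸ J
  finite := inferInstance
  graph := cosetGraph J X hX
  group := (cosetGraphHom hX).range

theorem cosetGraph_connected (hgen : Subgroup.closure X = ⊤) : (cosetGraph J X hX).Connected := by
  have key : ∀ n ∈ Subgroup.closure X, ∀ a : A,
      (cosetGraph J X hX).Reachable (a : A ⧸ J) ((a * n : A) : A ⧸ J) := by
    intro n hn
    induction hn using Subgroup.closure_induction with
    | mem n hn =>
      intro a
      by_cases e : (a : A ⧸ J) = ((a * n : A) : A ⧸ J)
      · exact e ▸ SimpleGraph.Reachable.refl _
      · exact SimpleGraph.Adj.reachable ⟨e, a, n, hn, rfl, rfl⟩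
    | one => exact fun a => by rw [mul_one]
    | mul x y _ _ hx hy => exact fun a => (hx a).trans (by rw [← mul_assoc]; exact hy (a * x))
    | inv x _ hx => exact fun a => by simpa using (hx (a * x⁻¹)).symm
  have : Nonempty (A ⧸ J) := ⟨((1 : A) : A ⧸ J)⟩
  refine ⟨fun p q => ?_⟩
  induction p using QuotientGroup.induction_on with | H a => ?_
  induction q using QuotientGroup.induction_on with | H b => ?_
  simpa using key (a⁻¹ * b) (hgen ▸ Subgroup.mem_top _) a

/-- By `hJX` the set of cosets meeting `X` is stable under `J`, so the neighbours of a coset do not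
depend on its representative. -/
theorem ncard_neighborSet_cosetGraph_le [Finite A]
    (hJX : ∀ j ∈ J, ∀ n ∈ X, ∃ n' ∈ X, ((j * n : A) : A ⧸ J) = n') (p : A ⧸ J) :
    ((cosetGraph J X hX).neighborSet p).ncard ≤
      {q : A ⧸ J | q ≠ ((1 : A) : A ⧸ J) ∧ ∃ n ∈ X, q = (n : A ⧸ J)}.ncard := by
  induction p using QuotientGroup.induction_on with | H a => ?_
  refine (Set.ncard_le_ncard (t := (fun q => a • q) ''
    {q : A ⧸ J | q ≠ ((1 : A) : A ⧸ J) ∧ ∃ n ∈ X, q = (n : A ⧸ J)}) ?_ (Set.toFinite _)).trans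
    (Set.ncard_image_le (Set.toFinite _))
  rintro _ ⟨hne, b, n, hn, hab, rfl⟩
  obtain ⟨n', hn', e⟩ := hJX (a⁻¹ * b) (QuotientGroup.eq.1 hab) n hn
  have e' : ((b * n : A) : A ⧸ J) = a • (n' : A ⧸ J) := by
    rw [← e, MulAction.Quotient.smul_coe, smul_eq_mul]
    congr 1
    group
  refine ⟨(n' : A ⧸ J), ⟨fun h1 => hne ?_, n', hn', rfl⟩, e'.symm⟩
  rw [e', h1, MulAction.Quotient.smul_coe, smul_eq_mul, mul_one]

variable {T : Type v} [Group T] [IsSimpleGroup T] {π : A →* T}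

/-- The kernel is the core of `π⁻¹(U)`. It contains `ker π`, and its image is a normal subgroup of
`T` inside the proper subgroup `U`. -/
theorem ker_cosetGraphHom (hπ : Function.Surjective π) {U : Subgroup T} (hU : U ≠ ⊤)
    (hX : ∀ n ∈ X, n⁻¹ ∈ X) : (cosetGraphHom (J := U.comap π) hX).ker = π.ker := by
  have mem : ∀ b : A, b ∈ (cosetGraphHom (J := U.comap π) hX).ker ↔
      ∀ a : A, π (a⁻¹ * b⁻¹ * a) ∈ U := by
    intro b
    rw [MonoidHom.mem_ker]
    constructor
    · intro hb a
      have := DFunLike.congr_fun hb ((a : A) : A ⧸ U.comap π)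
      have h2 : ((b * a : A) : A ⧸ U.comap π) = a := this
      have h3 := QuotientGroup.eq.1 h2
      simpa [mul_assoc] using h3
    · intro hb
      refine RelIso.ext fun p => ?_
      induction p using QuotientGroup.induction_on with | H a => ?_
      change ((b * a : A) : A ⧸ U.comap π) = a
      refine QuotientGroup.eq.2 ?_
      simpa [mul_assoc] using hb a
  have hle : π.ker ≤ (cosetGraphHom (J := U.comap π) hX).ker := by
    intro b hb
    rw [mem]
    intro a
    simp [MonoidHom.mem_ker.1 hb]
  refine le_antisymm ?_ hle
  have hn : ((cosetGraphHom (J := U.comap π) hX).ker.map π).Normal :=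
    Subgroup.Normal.map inferInstance π hπ
  rcases hn.eq_bot_or_eq_top with h | h
  · exact (Subgroup.map_eq_bot_iff _).1 h
  · refine absurd ((Subgroup.eq_top_iff' _).2 fun t => ?_) hU
    obtain ⟨b, hb, hbt⟩ : t⁻¹ ∈ (cosetGraphHom (J := U.comap π) hX).ker.map π :=
      h ▸ Subgroup.mem_top _
    have := (mem b).1 hb 1
    simpa [hbt] using this

theorem nonempty_cosetPair_group_mulEquiv [Finite A] (hπ : Function.Surjective π) {U : Subgroup T}
    (hU : U ≠ ⊤) (hX : ∀ n ∈ X, n⁻¹ ∈ X) :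
    Nonempty ((cosetPair (U.comap π) X hX).group ≃* T) :=
  ⟨(QuotientGroup.quotientKerEquivRange (cosetGraphHom (J := U.comap π) hX)).symm.trans
    ((QuotientGroup.quotientMulEquivOfEq (ker_cosetGraphHom hπ hU hX)).trans
      (QuotientGroup.quotientKerEquivOfSurjective π hπ))⟩

theorem cosetPair_isPretransitive [Finite A] (J : Subgroup A) (hX : ∀ n ∈ X, n⁻¹ ∈ X) :
    MulAction.IsPretransitive (cosetPair J X hX).group (cosetPair J X hX).V := by
  refine ⟨fun p q => ?_⟩
  obtain ⟨b, hb⟩ := MulAction.exists_smul_eq A (α := A ⧸ J) p q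
  exact ⟨⟨cosetGraphHom hX b, b, rfl⟩, hb⟩

theorem card_stabilizer_cosetPair [Finite A] (hπ : Function.Surjective π) {U : Subgroup T}
    (hU : U ≠ ⊤) (hX : ∀ n ∈ X, n⁻¹ ∈ X) (x : (cosetPair (U.comap π) X hX).V) :
    Nat.card (MulAction.stabilizer (cosetPair (U.comap π) X hX).group x) = Nat.card U := by
  have : Finite T := Finite.of_surjective π hπ
  obtain ⟨e⟩ := nonempty_cosetPair_group_mulEquiv hπ hU hX
  have := cosetPair_isPretransitive (U.comap π) hX
  have h1 := (MulAction.stabilizer (cosetPair (U.comap π) X hX).group x).card_mul_index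
  have h2 := U.card_mul_index
  have h3 : Nat.card (cosetPair (U.comap π) X hX).V = U.index := by
    rw [← Subgroup.index_comap_of_surjective U hπ]
    rfl
  rw [MulAction.index_stabilizer_of_transitive, Nat.card_congr e.toEquiv, ← h2, h3] at h1
  exact Nat.eq_of_mul_eq_mul_right (Nat.pos_of_ne_zero Subgroup.index_ne_zero_of_finite) h1

end CosetGraph

/-! ### The coset graph of a crossing edge -/

theorem ncard_image_le_of_injOn_factor {A β V : Type*} [Finite V] (f : A → β) (c : A → V)
    {s : Set A} {S : Set V} (hS : ∀ a ∈ s, c a ∈ S)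
    (h : ∀ a ∈ s, ∀ b ∈ s, c a = c b → f a = f b) : (f '' s).ncard ≤ S.ncard := by
  have : Set.range (fun a : s => f a) = f '' s := by
    ext
    simp
  rw [← this]
  exact ncard_range_le_of_factors _ (fun a : s => (⟨c a, hS a a.2⟩ : S))
    fun i j hij => h i i.2 j j.2 (congrArg Subtype.val hij)

section TwoOrbits

variable {V : Type*} {G : Type u} [Group G] [MulAction G V]
variable {Γ : SimpleGraph V} {M : Subgroup G} {T : Type v} [Group T]

/-- The translates of `w` under the stabiliser of `v` in `M`. -/
def suborbit (M : Subgroup G) (v w : V) : Set V := {β | ∃ a : M, a • v = v ∧ a • w = β}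

/-- The elements of `M` that move a crossing edge to one of the edges of its orbit near to it. -/
def nearSet (Γ : SimpleGraph V) (M : Subgroup G) (v w : V) : Set M :=
  {n | n • v = v ∨ n • w = w ∨
    n ∈ movingSet M v w (Γ.neighborSet v \ suborbit M v w ∪ Γ.neighborSet w \ suborbit M w v)}

theorem ncard_suborbit_mul_card [Finite V] [Finite G] (v w : V) :
    (suborbit M v w).ncard *
      Nat.card (MulAction.stabilizer M v ⊓ MulAction.stabilizer M w : Subgroup M) =
      Nat.card (MulAction.stabilizer M v) := by
  have h1 : (suborbit M v w).ncard =
      (MulAction.stabilizer M w).relIndex (MulAction.stabilizer M v) := by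
    have h2 : suborbit M v w = MulAction.orbit (MulAction.stabilizer M v) w := by
      ext β
      constructor
      · rintro ⟨a, ha, rfl⟩
        exact ⟨⟨a, ha⟩, rfl⟩
      · rintro ⟨⟨a, ha⟩, rfl⟩
        exact ⟨a, ha, rfl⟩
    rw [h2, ← MulAction.index_stabilizer]
    rfl
  rw [h1, mul_comm, ← Subgroup.inf_relIndex_left, ← Subgroup.relIndex_bot_left,
    ← Subgroup.relIndex_bot_left]
  exact Subgroup.relIndex_mul_relIndex _ _ _ bot_le inf_le_left

/-- With `k = 1 + j` and `d = k + e` the difference of the two sides is `(j² - j) + (e² - e)`. -/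
theorem two_mul_pred_add_le {d k : ℕ} (hk : 1 ≤ k) (hkd : k ≤ d) :
    2 * (k - 1) + 2 * (d - k) * k ≤ d * (d - 1) := by
  obtain ⟨e, rfl⟩ := Nat.exists_eq_add_of_le hkd
  obtain ⟨j, rfl⟩ := Nat.exists_eq_add_of_le hk
  have e1 : 1 + j - 1 = j := by omega
  have e2 : 1 + j + e - (1 + j) = e := by omega
  have e3 : 1 + j + e - 1 = j + e := by omega
  rw [e1, e2, e3]
  nlinarith [Nat.le_self_pow two_ne_zero j, Nat.le_self_pow two_ne_zero e]

namespace IsTwoOrbitAction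

variable (h : IsTwoOrbitAction Γ M)
include h

theorem suborbit_subset {v w : V} (hvw : Γ.Adj v w) : suborbit M v w ⊆ Γ.neighborSet v := by
  rintro _ ⟨a, ha, rfl⟩
  have := h.smul_adj (a : G) hvw
  rwa [show (a : G) • v = v from ha] at this

/-- If `n` moves `x` to a neighbour of `x`, so does its inverse, and that neighbour avoids the
suborbit because it lies in the orbit of `x`. If `n` moves `y` next to `x`, the inverse moves `x`
next to `y`, and membership in the suborbits corresponds. -/
theorem inv_mem_nearSet {v w : V} (hvw : IsCrossing Γ M v w) :
    ∀ n ∈ nearSet Γ M v w, n⁻¹ ∈ nearSet Γ M v w := by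
  have hadj : ∀ (n : M) (x y : V), Γ.Adj x (n • y) → Γ.Adj y (n⁻¹ • x) := by
    intro n x y hxy
    have := h.smul_adj ((n⁻¹ : M) : G) hxy
    rw [show ((n⁻¹ : M) : G) • n • y = y from inv_smul_smul n y] at this
    exact this.symm
  have hself : ∀ (n : M) (x y : V), IsCrossing Γ M x y → Γ.Adj x (n • x) →
      n⁻¹ • x ∈ Γ.neighborSet x \ suborbit M x y := by
    intro n x y hxy hn
    refine ⟨hadj n x x hn, ?_⟩
    rintro ⟨a, -, ha⟩
    exact hxy.symm.2 ⟨n * a, by simp only [mul_smul, ha, smul_inv_smul]⟩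
  have hother : ∀ (n : M) (x y : V), n • y ∈ Γ.neighborSet x \ suborbit M x y →
      n⁻¹ • x ∈ Γ.neighborSet y \ suborbit M y x := by
    rintro n x y ⟨hn, hn'⟩
    refine ⟨hadj n x y hn, ?_⟩
    rintro ⟨a, ha, ha'⟩
    exact hn' ⟨n * a, by rw [mul_smul, ha', smul_inv_smul], by rw [mul_smul, ha]⟩
  rintro n (hn | hn | (hn | hn) | (hn | hn))
  · exact Or.inl (inv_smul_eq_iff.2 hn.symm)
  · exact Or.inr (Or.inl (inv_smul_eq_iff.2 hn.symm))
  · exact Or.inr (Or.inr (Or.inl (Or.inl (hself n v w hvw hn.1))))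
  · exact Or.inr (Or.inr (Or.inr (Or.inl (hother n w v hn))))
  · exact Or.inr (Or.inr (Or.inl (Or.inr (hother n v w hn))))
  · exact Or.inr (Or.inr (Or.inr (Or.inr (hself n w v hvw.symm hn.1))))

theorem mul_mem_nearSet {v w : V} {l n : M}
    (hl : l ∈ MulAction.stabilizer M v ⊓ MulAction.stabilizer M w) (hn : n ∈ nearSet Γ M v w) :
    l * n ∈ nearSet Γ M v w := by
  have hlv : l • v = v := hl.1
  have hlw : l • w = w := hl.2
  have key : ∀ x y β : V, l • x = x → l • y = y → β ∈ Γ.neighborSet x \ suborbit M x y →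
      l • β ∈ Γ.neighborSet x \ suborbit M x y := by
    rintro x y β hx hy ⟨hβ, hβ'⟩
    refine ⟨?_, ?_⟩
    · have := h.smul_adj (l : G) hβ
      rwa [show (l : G) • x = x from hx] at this
    · rintro ⟨a, ha, ha'⟩
      refine hβ' ⟨l⁻¹ * a, ?_, ?_⟩
      · rw [mul_smul, ha, inv_smul_eq_iff, hx]
      · rw [mul_smul, ha', inv_smul_smul]
  have key' : ∀ β : V,
      β ∈ Γ.neighborSet v \ suborbit M v w ∪ Γ.neighborSet w \ suborbit M w v →
      l • β ∈ Γ.neighborSet v \ suborbit M v w ∪ Γ.neighborSet w \ suborbit M w v := fun β hβ =>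
    hβ.imp (key v w β hlv hlw) (key w v β hlw hlv)
  rcases hn with hn | hn | hn
  · exact Or.inl (by rw [mul_smul, hn, hlv])
  · exact Or.inr (Or.inl (by rw [mul_smul, hn, hlw]))
  · refine Or.inr (Or.inr (hn.imp ?_ ?_))
    · intro hn
      rw [mul_smul]
      exact key' _ hn
    · intro hn
      rw [mul_smul]
      exact key' _ hn

/-- The closure contains `M_v` and is transitive on the orbit of `v`. -/
theorem closure_nearSet {v w : V} (hvw : IsCrossing Γ M v w) :
    Subgroup.closure (nearSet Γ M v w) = ⊤ := by
  have key : ∀ β : V, β ∈ Γ.neighborSet v \ suborbit M v w ∪ Γ.neighborSet w \ suborbit M w v →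
      ∃ n ∈ Subgroup.closure (nearSet Γ M v w), n • v = β ∨ n • w = β := by
    intro β hβ
    rcases h.mem_orbit_of_isCrossing hvw β with ⟨n, rfl⟩ | ⟨n, rfl⟩
    · exact ⟨n, Subgroup.subset_closure (Or.inr (Or.inr (Or.inl hβ))), Or.inl rfl⟩
    · exact ⟨n, Subgroup.subset_closure (Or.inr (Or.inr (Or.inr hβ))), Or.inr rfl⟩
  refine (Subgroup.eq_top_iff' _).2 fun a => ?_
  have hv : ∀ β, Γ.Adj v β → ∃ n ∈ Subgroup.closure (nearSet Γ M v w), n • v = β ∨ n • w = β := by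
    intro β hβ
    by_cases hs : β ∈ suborbit M v w
    · obtain ⟨b, hb, rfl⟩ := hs
      exact ⟨b, Subgroup.subset_closure (Or.inl hb), Or.inr rfl⟩
    · exact key β (Or.inl ⟨hβ, hs⟩)
  have hw : ∀ β, Γ.Adj w β → ∃ n ∈ Subgroup.closure (nearSet Γ M v w), n • v = β ∨ n • w = β := by
    intro β hβ
    by_cases hs : β ∈ suborbit M w v
    · obtain ⟨b, hb, rfl⟩ := hs
      exact ⟨b, Subgroup.subset_closure (Or.inr (Or.inl hb)), Or.inl rfl⟩
    · exact key β (Or.inr ⟨hβ, hs⟩)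
  obtain ⟨n, hn, hna⟩ := h.exists_smul_eq_smul hvw hv hw (Or.inl rfl) a
  have : n⁻¹ * a ∈ Subgroup.closure (nearSet Γ M v w) :=
    Subgroup.subset_closure (Or.inl (by rw [mul_smul, ← hna, inv_smul_smul]))
  simpa using mul_mem hn this

/-- Let `k` be the common length of the two suborbits, equal because `M_v` and `M_w` have the same
order. Each of `M_v` and `M_w` contributes at most `k - 1` nontrivial cosets, and each of the at
most `2 * (d - k)` neighbours outside the suborbits at most `k`. Removing the suborbits from the
moving set is what brings the total down to `d * (d - 1)`. -/
theorem ncard_nearSet_cosets_le [M.Normal] [Finite V] [Finite G] {d : ℕ}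
    (hd : ∀ x, (Γ.neighborSet x).ncard ≤ d) {v w : V} (hvw : IsCrossing Γ M v w)
    {J : Subgroup M} (hJ : MulAction.stabilizer M v ⊓ MulAction.stabilizer M w ≤ J) :
    {q : M ⧸ J | q ≠ ((1 : M) : M ⧸ J) ∧ ∃ n ∈ nearSet Γ M v w, q = (n : M ⧸ J)}.ncard ≤
      d * (d - 1) := by
  set k := (suborbit M v w).ncard with hk
  have hk' : (suborbit M w v).ncard = k := by
    have h1 := ncard_suborbit_mul_card (M := M) v w
    have h2 := ncard_suborbit_mul_card (M := M) w v
    rw [inf_comm, h.card_stabilizer_eq v w, ← h1] at h2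
    exact Nat.eq_of_mul_eq_mul_right Nat.card_pos h2
  have hw : w ∈ suborbit M v w := ⟨1, one_smul _ _, one_smul _ _⟩
  have hv : v ∈ suborbit M w v := ⟨1, one_smul _ _, one_smul _ _⟩
  have hk1 : 1 ≤ k := (Set.ncard_pos (Set.toFinite _)).2 ⟨w, hw⟩
  have hsub : ∀ x y : V, Γ.Adj x y → (Γ.neighborSet x \ suborbit M x y).ncard ≤
      d - (suborbit M x y).ncard := by
    intro x y hxy
    rw [Set.ncard_sdiff (h.suborbit_subset hxy)]
    exact Nat.sub_le_sub_right (hd x) _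
  have hkd : k ≤ d := (Set.ncard_le_ncard (h.suborbit_subset hvw.1) (Set.toFinite _)).trans (hd v)
  have hcoset : ∀ x y : V, MulAction.stabilizer M x ⊓ MulAction.stabilizer M y ≤ J →
      ∀ (s : Set M), (∀ a ∈ s, ∀ b ∈ s, a • x = b • x) →
      ((fun n : M => (n : M ⧸ J)) '' s).ncard ≤ (suborbit M x y).ncard := by
    intro x y hxy s hs
    rcases s.eq_empty_or_nonempty with rfl | ⟨a, ha⟩
    · simp
    refine ncard_image_le_of_injOn_factor _ (fun b => (a⁻¹ * b) • y) (fun b hb => ?_) ?_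
    · exact ⟨a⁻¹ * b, by rw [mul_smul, hs b hb a ha, inv_smul_smul], rfl⟩
    · intro b hb c hc e
      refine QuotientGroup.eq.2 (hxy ⟨?_, ?_⟩)
      · change (b⁻¹ * c) • x = x
        rw [mul_smul, hs c hc b hb, inv_smul_smul]
      · change (b⁻¹ * c) • y = y
        simp only [mul_smul] at e
        rw [mul_smul, ← MulAction.injective _ e, inv_smul_smul]
  have hstab : ∀ x y : V, MulAction.stabilizer M x ⊓ MulAction.stabilizer M y ≤ J →
      y ∈ suborbit M x y →
      ((fun n : M => (n : M ⧸ J)) '' {n | n • x = x ∧ (n : M ⧸ J) ≠ ((1 : M) : M ⧸ J)}).ncard ≤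
        (suborbit M x y).ncard - 1 := by
    intro x y hxy hy
    rw [← Set.ncard_sdiff_singleton_of_mem hy]
    refine ncard_image_le_of_injOn_factor _ (fun b => b • y) ?_ ?_
    · rintro b ⟨hb, hb1⟩
      refine ⟨⟨b, hb, rfl⟩, fun e => hb1 ?_⟩
      refine (QuotientGroup.eq.2 (hxy ?_)).symm
      rw [inv_one, one_mul]
      exact ⟨hb, e⟩
    · rintro b ⟨hb, -⟩ c ⟨hc, -⟩ e
      refine QuotientGroup.eq.2 (hxy ⟨?_, ?_⟩)
      · change (b⁻¹ * c) • x = x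
        rw [mul_smul, hc, inv_smul_eq_iff, hb]
      · change (b⁻¹ * c) • y = y
        have e' : b • y = c • y := e
        rw [mul_smul, ← e', inv_smul_smul]
  set S := Γ.neighborSet v \ suborbit M v w ∪ Γ.neighborSet w \ suborbit M w v with hS
  have hScard : S.ncard ≤ 2 * (d - k) := by
    refine (Set.ncard_union_le _ _).trans ?_
    have h1 := hsub v w hvw.1
    have h2 := hsub w v hvw.1.symm
    rw [hk'] at h2
    omega
  have hmov : ((fun n : M => (n : M ⧸ J)) '' movingSet M v w S).ncard ≤ S.ncard * k := by
    refine ncard_le_of_subset_biUnion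
      (t := fun β => (fun n : M => (n : M ⧸ J)) '' {n : M | n • v = β ∨ n • w = β}) ?_ ?_
    · rintro _ ⟨n, hn | hn, rfl⟩
      · exact ⟨_, hn, n, Or.inl rfl, rfl⟩
      · exact ⟨_, hn, n, Or.inr rfl, rfl⟩
    · intro β _
      by_cases hβ : β ∈ MulAction.orbit M v
      · have key : ∀ n : M, n • v = β ∨ n • w = β → n • v = β := by
          rintro n (hn | hn)
          · exact hn
          · obtain ⟨m, hm⟩ := hβ
            exact absurd ⟨n⁻¹ * m, by
              simp only [mul_smul, inv_smul_eq_iff]; exact hm.trans hn.symm⟩ hvw.2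
        exact hcoset v w hJ _ fun a ha b hb => (key a ha).trans (key b hb).symm
      · have key : ∀ n : M, n • v = β ∨ n • w = β → n • w = β := by
          rintro n (hn | hn)
          · exact absurd ⟨n, hn⟩ hβ
          · exact hn
        rw [← hk']
        exact hcoset w v (inf_comm (MulAction.stabilizer M v) _ ▸ hJ) _
          fun a ha b hb => (key a ha).trans (key b hb).symm
  have h1 := hstab v w hJ hw
  have h2 := hstab w v (inf_comm (MulAction.stabilizer M v) _ ▸ hJ) hv
  rw [hk'] at h2
  refine le_trans ?_ (two_mul_pred_add_le hk1 hkd)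
  have hcover : {q : M ⧸ J | q ≠ ((1 : M) : M ⧸ J) ∧ ∃ n ∈ nearSet Γ M v w, q = (n : M ⧸ J)} ⊆
      ((fun n : M => (n : M ⧸ J)) '' {n | n • v = v ∧ (n : M ⧸ J) ≠ ((1 : M) : M ⧸ J)} ∪
      (fun n : M => (n : M ⧸ J)) '' {n | n • w = w ∧ (n : M ⧸ J) ≠ ((1 : M) : M ⧸ J)}) ∪
      (fun n : M => (n : M ⧸ J)) '' movingSet M v w S := by
    rintro _ ⟨hq, n, hn | hn | hn, rfl⟩
    · exact Or.inl (Or.inl ⟨n, ⟨hn, hq⟩, rfl⟩)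
    · exact Or.inl (Or.inr ⟨n, ⟨hn, hq⟩, rfl⟩)
    · exact Or.inr ⟨n, hn, rfl⟩
  refine (Set.ncard_le_ncard hcover (Set.toFinite _)).trans ((Set.ncard_union_le _ _).trans ?_)
  have h3 := Set.ncard_union_le
    ((fun n : M => (n : M ⧸ J)) '' {n | n • v = v ∧ (n : M ⧸ J) ≠ ((1 : M) : M ⧸ J)})
    ((fun n : M => (n : M ⧸ J)) '' {n | n • w = w ∧ (n : M ⧸ J) ≠ ((1 : M) : M ⧸ J)})
  have h4 := hmov.trans (Nat.mul_le_mul_right k hScard)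
  rw [← hk] at h1
  omega

/-- The coset graph attached to a crossing edge `{v, w}` and a simple quotient of `M`. -/
def pair [Finite G] (π : M →* T) {v w : V} (hvw : IsCrossing Γ M v w) : GraphPair.{u} :=
  cosetPair (((MulAction.stabilizer M v ⊓ MulAction.stabilizer M w).map π).comap π)
    (nearSet Γ M v w) (h.inv_mem_nearSet hvw)

theorem pair_inA [M.Normal] [Finite V] [Finite G] (π : M →* T)
    {d : ℕ} (hd : ∀ x, (Γ.neighborSet x).ncard ≤ d) {v w : V} (hvw : IsCrossing Γ M v w) :
    (h.pair π hvw).InA (d * (d - 1)) := by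
  refine ⟨cosetGraph_connected (h.inv_mem_nearSet hvw) (h.closure_nearSet hvw),
    cosetPair_isPretransitive _ (h.inv_mem_nearSet hvw),
    fun x => (ncard_neighborSet_cosetGraph_le (h.inv_mem_nearSet hvw) ?_ x).trans
      (h.ncard_nearSet_cosets_le hd hvw (Subgroup.le_comap_map _ _))⟩
  rintro j ⟨l, hl, hlj⟩ n hn
  refine ⟨l * n, h.mul_mem_nearSet hl hn, QuotientGroup.eq.2 ?_⟩
  rw [Subgroup.mem_comap]
  simp [hlj]

end IsTwoOrbitAction
end TwoOrbits

/-! ### Arithmetic -/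

theorem le_absoluteBound {d : ℕ} (hd : 0 < d) : d ≤ absoluteBound d := by
  refine le_trans ?_ (Nat.self_le_factorial _)
  have : 0 < ((d * (d - 1))!) ^ 2 := pow_pos (Nat.factorial_pos _) 2
  nlinarith

theorem mul_factorial_le_factorial {d n m : ℕ} (hd : d ≤ n + 1) (hm : n + 1 ≤ m) :
    d * n ! ≤ m ! :=
  ((Nat.mul_le_mul_right _ hd).trans (Nat.factorial_succ n).ge).trans (Nat.factorial_le hm)

theorem mul_factorial_le_absoluteBound {d a : ℕ} (hd : 3 ≤ d) (ha : 0 < a)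
    (had : a ≤ d * (d !) ^ 2) : d * (2 * d * a)! ≤ absoluteBound d := by
  refine mul_factorial_le_factorial ?_ ?_
  · nlinarith
  -- For `d ≥ 3` this replaces `d !` by a factorial at least four times as large, which absorbs the
  -- constant `2` and the `+ 1`.
  · have h1 : d + 1 ≤ d * (d - 1) := by
      obtain ⟨e, rfl⟩ := Nat.exists_eq_add_of_le hd
      have : 3 + e - 1 = 2 + e := by omega
      rw [this]
      nlinarith
    have h2 : (d + 1) * d ! ≤ (d * (d - 1))! :=
      (Nat.factorial_succ d).ge.trans (Nat.factorial_le h1)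
    have h3 : 4 * d ! ≤ (d * (d - 1))! := (Nat.mul_le_mul_right _ (by omega)).trans h2
    have h4 := Nat.pow_le_pow_left h3 2
    have h5 : 1 ≤ d ! := Nat.factorial_pos d
    generalize (d * (d - 1))! = y at *
    generalize d ! = z at *
    have h6 : 1 ≤ d ^ 2 * z ^ 2 := Nat.mul_pos (by positivity) (by positivity)
    calc 2 * d * a + 1 ≤ 2 * d * (d * z ^ 2) + 1 := by gcongr
      _ ≤ d ^ 2 * (4 * z) ^ 2 := by nlinarith
      _ ≤ d ^ 2 * y ^ 2 := Nat.mul_le_mul_left _ h4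

theorem mul_factorial_le_starBar {d a m : ℕ} {g₁ g₂ : ℕ → ℕ} (hd : 3 ≤ d) (ha : 0 < a)
    (hm : m = min (g₁ (d * (d - 1))) (g₂ (d * (d - 1)))) (hm2 : 2 ≤ m)
    (had : a ≤ (d * m) ^ (2 * d * ((d - 1) * (d * m)) ^ (2 * (d - 1)))) :
    d * (2 * d * a)! ≤ starBar g₁ g₂ d := by
  simp only [starBar]
  rw [← hm]
  have hP : m ^ 2 ≤ g₁ (d * (d - 1)) * g₂ (d * (d - 1)) := by
    rw [sq]
    exact Nat.mul_le_mul (hm ▸ min_le_left _ _) (hm ▸ min_le_right _ _)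
  generalize g₁ (d * (d - 1)) * g₂ (d * (d - 1)) = P at *
  have hd0 : 2 * d ≤ d * (d - 1) := by
    rw [mul_comm]
    exact Nat.mul_le_mul_left _ (by omega)
  have hdm : (d - 1) * (d * m) = d * (d - 1) * m := by ring
  rw [hdm] at had
  generalize hq : d * (d - 1) = q at *
  refine mul_factorial_le_factorial (by nlinarith) ?_
  have hP1 : 2 ≤ P := by nlinarith
  -- Since `m ≥ 2`, the factor `d` is absorbed by `m ^ d`.
  have hB : d * m ≤ P ^ d := by
    calc d * m ≤ 2 ^ d * m := Nat.mul_le_mul_right _ Nat.lt_two_pow_self.le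
      _ ≤ m ^ d * m ^ d := Nat.mul_le_mul (Nat.pow_le_pow_left hm2 d)
          (Nat.le_self_pow (by omega) m)
      _ = (m ^ 2) ^ d := by ring
      _ ≤ P ^ d := Nat.pow_le_pow_left hP d
  have ha' : a ≤ P ^ (d * (2 * d * (q * m) ^ (2 * (d - 1)))) := by
    rw [pow_mul]
    exact had.trans (Nat.pow_le_pow_left hB _)
  -- The spare `1` in the exponent pays for the summand `1` in `a + 1` below.
  have hE : d * (2 * d * (q * m) ^ (2 * (d - 1))) + 1 ≤ q ^ q * m ^ (2 * q) := by
    have hq0 : 0 < q := by omega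
    have h1 : 1 ≤ (q * m) ^ (2 * (d - 1)) := Nat.one_le_pow _ _ (by positivity)
    have h4 : (2 * d) ^ 2 ≤ q ^ 2 := Nat.pow_le_pow_left hd0 2
    have h5 : ∀ t, 1 ≤ t → d * (2 * d * t) + 1 ≤ q ^ 2 * t := fun t ht => by
      have h6 : 1 ≤ d * d * t := Nat.mul_pos (by positivity) ht
      nlinarith [Nat.mul_le_mul_right t h4]
    calc d * (2 * d * (q * m) ^ (2 * (d - 1))) + 1
        ≤ q ^ 2 * (q * m) ^ (2 * (d - 1)) := h5 _ h1
      _ = q ^ (2 + 2 * (d - 1)) * m ^ (2 * (d - 1)) := by rw [mul_pow, pow_add, mul_assoc]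
      _ ≤ q ^ q * m ^ (2 * q) := Nat.mul_le_mul (Nat.pow_le_pow_right hq0 (by omega))
          (Nat.pow_le_pow_right (by omega) (by omega))
  have h2 : P ^ (d * (2 * d * (q * m) ^ (2 * (d - 1)))) + 1 ≤ P ^ (q ^ q * m ^ (2 * q)) := by
    refine le_trans ?_ (Nat.pow_le_pow_right (by omega) hE)
    rw [pow_succ]
    have : 1 ≤ P ^ (d * (2 * d * (q * m) ^ (2 * (d - 1)))) := Nat.one_le_pow _ _ (by omega)
    nlinarith
  calc 2 * d * a + 1 ≤ q * (a + 1) := by nlinarith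
    _ ≤ q * P ^ (q ^ q * m ^ (2 * q)) :=
      Nat.mul_le_mul_left _ ((Nat.add_le_add_right ha' 1).trans h2)

/-- The number `d * (d - 1)` is the upper end of the interval belonging to `d`, so `tilde f` returns
`f d` at the new valency. -/
theorem tildeIndex_mul_pred {d : ℕ} (hd : 2 ≤ d) : tildeIndex (d * (d - 1)) = d := by
  have hpos : 0 < d * (d - 1) := Nat.mul_pos (by omega) (by omega)
  refine (existsUnique_isTildeIndex hpos).unique (isTildeIndex_tildeIndex hpos) ?_
  rw [IsTildeIndex, Nat.cast_mul, Nat.cast_sub (by omega)]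
  refine ⟨?_, le_of_eq (by simp)⟩
  push_cast
  have : (2 : ℤ) ≤ d := by exact_mod_cast hd
  nlinarith

/-! ### Transport along isomorphisms of pairs -/

section Transport

variable {G G' X Y : Type*} [Group G] [Group G'] [MulAction G X] [MulAction G' Y]

theorem mem_orbit_comap_iff (s : G ≃* G') (e : X ≃ Y) (he : ∀ (g : G) (x : X), e (g • x) = s g • e x)
    (N : Subgroup G') (x y : X) :
    x ∈ MulAction.orbit (N.comap s.toMonoidHom) y ↔ e x ∈ MulAction.orbit N (e y) := by
  constructor
  · rintro ⟨⟨g, hg⟩, rfl⟩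
    exact ⟨⟨s g, hg⟩, (he g y).symm⟩
  · rintro ⟨⟨g, hg⟩, hx⟩
    refine ⟨⟨s.symm g, by simpa using hg⟩, e.injective ?_⟩
    change e (s.symm g • y) = e x
    rw [he, MulEquiv.apply_symm_apply]
    exact hx

theorem IsQuasiprimitive.transport (s : G ≃* G') (e : X ≃ Y)
    (he : ∀ (g : G) (x : X), e (g • x) = s g • e x) (h : IsQuasiprimitive G X) :
    IsQuasiprimitive G' Y := by
  intro N hN hb
  have h1 := h (N.comap s.toMonoidHom) (hN.comap _) fun hc => hb ?_
  · refine ⟨fun x y => ?_⟩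
    have := (mem_orbit_comap_iff s e he N (e.symm y) (e.symm x)).1
      (MulAction.mem_orbit_iff.2 (MulAction.exists_smul_eq _ (e.symm x) (e.symm y)))
    rw [e.apply_symm_apply, e.apply_symm_apply] at this
    exact this
  · exact (Subgroup.eq_bot_iff_forall _).2 fun g hg => by
      have : s.symm g ∈ N.comap s.toMonoidHom := by simpa using hg
      rw [hc, Subgroup.mem_bot] at this
      simpa using this

theorem IsBiquasiprimitive.transport (s : G ≃* G') (e : X ≃ Y)
    (he : ∀ (g : G) (x : X), e (g • x) = s g • e x) (h : IsBiquasiprimitive G X) :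
    IsBiquasiprimitive G' Y := by
  refine ⟨fun hq => h.1 (hq.transport s.symm e.symm fun g y => ?_), fun N hN hb => ?_⟩
  · apply e.injective
    rw [he]
    simp
  · have h1 := h.2 (N.comap s.toMonoidHom) (hN.comap _) fun hc => hb ?_
    · refine le_of_eq_of_le (Nat.card_congr (Quotient.congr e fun x y => ?_)).symm h1
      exact mem_orbit_comap_iff s e he N x y
    · exact (Subgroup.eq_bot_iff_forall _).2 fun g hg => by
        have : s.symm g ∈ N.comap s.toMonoidHom := by simpa using hg
        rw [hc, Subgroup.mem_bot] at this
        simpa using this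

theorem IsMinimalNormal.map (s : G ≃* G') {N : Subgroup G} (h : IsMinimalNormal N) :
    IsMinimalNormal (N.map s.toMonoidHom) := by
  refine ⟨h.1.map _ s.surjective, ?_, fun K hK hKN => ?_⟩
  · rw [Ne, Subgroup.map_eq_bot_iff_of_injective _ s.injective]
    exact h.2.1
  · have hKc : (K.comap s.toMonoidHom).map s.toMonoidHom = K :=
      Subgroup.map_comap_eq_self_of_surjective s.surjective K
    rcases h.2.2 (K.comap s.toMonoidHom) (hK.comap _) (by
      rw [← Subgroup.comap_map_eq_self_of_injective (f := s.toMonoidHom) s.injective N]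
      exact Subgroup.comap_mono hKN) with h' | h'
    · left
      rw [← hKc, h', Subgroup.map_bot]
    · right
      rw [← hKc, h']

theorem map_socle_le (s : G ≃* G') : (socle G).map s.toMonoidHom ≤ socle G' := by
  rw [Subgroup.map_le_iff_le_comap]
  exact sSup_le fun N hN => Subgroup.map_le_iff_le_comap.1 (le_sSup (hN.map s))

theorem map_socle (s : G ≃* G') : (socle G).map s.toMonoidHom = socle G' := by
  refine le_antisymm (map_socle_le s) fun x hx => ?_
  exact ⟨s.symm x, map_socle_le s.symm ⟨x, hx, rfl⟩, by simp⟩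

theorem IsSocleFactor.transport (s : G ≃* G') {T : Type*} [Group T] (h : IsSocleFactor G T) :
    IsSocleFactor G' T := by
  obtain ⟨hs, l, hl, ⟨f⟩⟩ := h
  refine ⟨hs, l, hl, ⟨?_⟩⟩
  exact (MulEquiv.subgroupCongr (map_socle s)).symm.trans ((s.subgroupMap (socle G)).symm.trans f)

end Transport

namespace GraphPair

theorem Iso.refl (P : GraphPair.{u}) : P.Iso P :=
  ⟨SimpleGraph.Iso.refl, fun _ => Iff.rfl⟩

theorem Iso.symm {P Q : GraphPair.{u}} (h : P.Iso Q) : Q.Iso P := by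
  obtain ⟨e, he⟩ := h
  refine ⟨e.symm, fun g => ?_⟩
  rw [he]
  refine iff_of_eq (congrArg (· ∈ P.group) ?_)
  refine RelIso.ext fun x => ?_
  simp

theorem Iso.exists_equivariant {P Q : GraphPair.{u}} (h : P.Iso Q) :
    ∃ (e : P.graph ≃g Q.graph) (s : P.group ≃* Q.group),
      ∀ (g : P.group) (x : P.V), e (g • x) = s g • e x := by
  obtain ⟨e, he⟩ := h
  have h1 : ∀ g : P.graph ≃g P.graph, (e.trans ((e.symm.trans g).trans e)).trans e.symm = g :=
    fun g => RelIso.ext fun x => by simp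
  have h2 : ∀ g : Q.graph ≃g Q.graph, (e.symm.trans ((e.trans g).trans e.symm)).trans e = g :=
    fun g => RelIso.ext fun x => by simp
  refine ⟨e, { toFun := fun g => ⟨(e.symm.trans g.1).trans e, (he _).2 (by rw [h1]; exact g.2)⟩,
               invFun := fun g => ⟨(e.trans g.1).trans e.symm, (he _).1 g.2⟩,
               left_inv := fun g => Subtype.ext (h1 _),
               right_inv := fun g => Subtype.ext (h2 _),
               map_mul' := fun g g' => Subtype.ext (RelIso.ext fun x => ?_) }, fun g x => ?_⟩
  · change e (g.1 (g'.1 (e.symm x))) = e (g.1 (e.symm (e (g'.1 (e.symm x)))))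
    rw [RelIso.symm_apply_apply]
  · change e (g.1 x) = e (g.1 (e.symm (e x)))
    rw [RelIso.symm_apply_apply]

theorem Iso.inA {P Q : GraphPair.{u}} (h : P.Iso Q) {d : ℕ} (hP : P.InA d) : Q.InA d := by
  obtain ⟨e, s, he⟩ := h.exists_equivariant
  obtain ⟨h1, h2, h3⟩ := hP
  refine ⟨e.connected_iff.1 h1, ⟨fun x y => ?_⟩, fun x => ?_⟩
  · obtain ⟨g, hg⟩ := MulAction.exists_smul_eq P.group (e.symm x) (e.symm y)
    refine ⟨s g, ?_⟩
    have := he g (e.symm x)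
    rw [hg, RelIso.apply_symm_apply, RelIso.apply_symm_apply] at this
    exact this.symm
  · refine le_of_eq_of_le ?_ (h3 (e.symm x))
    exact (Nat.card_congr (e.symm.mapNeighborSet x))

theorem Iso.isBounded {P Q : GraphPair.{u}} (h : P.Iso Q) {d : ℕ} {f : ℕ → ℕ}
    (hP : P.IsBounded d f) : Q.IsBounded d f := by
  obtain ⟨e, s, he⟩ := h.symm.exists_equivariant
  intro x
  have := P.finite
  have : Finite (P.graph ≃g P.graph) := Finite.of_injective _ RelIso.toEquiv_injective
  refine le_trans (Nat.card_le_card_of_injective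
    (fun g : MulAction.stabilizer Q.group x =>
      (⟨s g, ?_⟩ : MulAction.stabilizer P.group (e x))) fun g g' hg => ?_) (hP (e x))
  · rw [MulAction.mem_stabilizer_iff, ← he, MulAction.mem_stabilizer_iff.1 g.2]
  · exact Subtype.ext (s.injective (congrArg Subtype.val hg))

end GraphPair

/-! ### The reduction to simple groups -/

section Reduction

variable {V : Type u} {G : Type u} [Group G] [MulAction G V] {Γ : SimpleGraph V}

/-- A biquasiprimitive group has a minimal normal subgroup with exactly two orbits. -/
theorem IsBiquasiprimitive.exists_isTwoOrbitAction [Finite V] [Finite G]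
    [MulAction.IsPretransitive G V] (hG : IsBiquasiprimitive G V) (hΓ : Γ.Connected)
    (hadj : ∀ (g : G) {v w : V}, Γ.Adj v w → Γ.Adj (g • v) (g • w)) :
    ∃ M : Subgroup G, IsMinimalNormal M ∧ IsTwoOrbitAction Γ M := by
  obtain ⟨hq, hN⟩ := hG
  simp only [IsQuasiprimitive, not_forall] at hq
  obtain ⟨N, hNn, hNb, hNt⟩ := hq
  -- Being contained in an intransitive subgroup, `M` is intransitive.
  obtain ⟨M, hMN, hM⟩ := exists_isMinimalNormal_le N hNn hNb
  refine ⟨M, hM, hΓ, hadj, fun v w => MulAction.exists_smul_eq G v w, ?_, ?_⟩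
  · intro v w hvw z
    by_contra! hz
    have h3 : ({Quotient.mk (MulAction.orbitRel M V) v, Quotient.mk (MulAction.orbitRel M V) w,
        Quotient.mk (MulAction.orbitRel M V) z} :
        Set (MulAction.orbitRel.Quotient M V)).ncard = 3 := by
      refine Set.ncard_eq_three.2 ⟨_, _, _, ?_, ?_, ?_, rfl⟩
      · exact fun e => hvw (MulAction.mem_orbit_symm.1 (Quotient.exact e))
      · exact fun e => hz.1 (MulAction.mem_orbit_symm.1 (Quotient.exact e))
      · exact fun e => hz.2 (MulAction.mem_orbit_symm.1 (Quotient.exact e))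
    have h2 := hN M hM.1 hM.2.1
    have := Set.ncard_le_ncard (Set.subset_univ
      ({Quotient.mk (MulAction.orbitRel M V) v, Quotient.mk (MulAction.orbitRel M V) w,
        Quotient.mk (MulAction.orbitRel M V) z} : Set (MulAction.orbitRel.Quotient M V)))
      (Set.toFinite _)
    rw [h3, Set.ncard_univ] at this
    omega
  · by_contra! hcon
    refine hNt ⟨fun v w => ?_⟩
    obtain ⟨a, ha⟩ := hcon v w
    exact ⟨⟨a, hMN a.2⟩, ha⟩

theorem card_map_inf_stabilizer_le {M : Subgroup G} {T : Type v} [Group T] [Finite G]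
    (π : M →* T) (v w : V) :
    Nat.card ((MulAction.stabilizer M v ⊓ MulAction.stabilizer M w).map π) ≤
      Nat.card (MulAction.stabilizer G v) := by
  refine (Nat.le_of_dvd Nat.card_pos (Subgroup.card_map_dvd _ _)).trans ?_
  exact Nat.card_le_card_of_injective
    (fun a : (MulAction.stabilizer M v ⊓ MulAction.stabilizer M w : Subgroup M) =>
      (⟨((a : M) : G), a.2.1⟩ : MulAction.stabilizer G v))
    fun a b hab => Subtype.ext (Subtype.ext
      (congrArg (fun y : MulAction.stabilizer G v => (y : G)) hab))

/-- The ball stabiliser at `v` lies in `M_vw`. This provides the lower bound `2` on which the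
arithmetic for `starBar` relies. -/
theorem IsCrossing.two_le_card_map_inf_stabilizer {M : Subgroup G} {T : Type v} [Group T]
    [Finite T] {π : M →* T}
    (hball : ∀ x, (ballStabilizer Γ M x).map π ≠ ⊥) {v w : V} (hvw : IsCrossing Γ M v w) :
    2 ≤ Nat.card ((MulAction.stabilizer M v ⊓ MulAction.stabilizer M w).map π) := by
  rw [Nat.succ_le_iff, Subgroup.one_lt_card_iff_ne_bot]
  intro hb
  refine hball v (le_bot_iff.1 (hb ▸ Subgroup.map_mono ?_))
  exact le_inf ballStabilizer_le (ballStabilizer_le_of_adj hvw.1)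

namespace IsTwoOrbitAction

variable {M : Subgroup G} (h : IsTwoOrbitAction Γ M) {T : Type v} [Group T]
include h

theorem card_map_stabilizer_le_mul [M.Normal] [Finite V] [Finite G] [Finite T] (π : M →* T) {d : ℕ}
    (hd : ∀ x, (Γ.neighborSet x).ncard ≤ d) {v w : V} (hvw : IsCrossing Γ M v w) (x : V) :
    Nat.card ((MulAction.stabilizer M x).map π) ≤
      d * Nat.card ((MulAction.stabilizer M v ⊓ MulAction.stabilizer M w).map π) := by
  rcases h.mem_orbit_of_isCrossing hvw x with hx | hx
  · rw [isEquivariant_stabilizer.card_map_eq_of_mem_orbit π hx]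
    exact h.card_map_stabilizer_le π hd hvw.1
  · rw [isEquivariant_stabilizer.card_map_eq_of_mem_orbit π hx, inf_comm]
    exact h.card_map_stabilizer_le π hd hvw.1.symm

theorem map_inf_stabilizer_ne_top [M.Normal] {π : M →* T}
    (hne : ∃ x : V, (MulAction.stabilizer M x).map π ≠ ⊤) {v w : V} (hvw : IsCrossing Γ M v w) :
    (MulAction.stabilizer M v ⊓ MulAction.stabilizer M w).map π ≠ ⊤ := by
  intro htop
  rcases h.map_ne_top_of_isCrossing hne hvw with hn | hn
  · exact hn (top_le_iff.1 (htop.ge.trans (Subgroup.map_mono inf_le_left)))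
  · exact hn (top_le_iff.1 (htop.ge.trans (Subgroup.map_mono inf_le_right)))

variable [IsSimpleGroup T]

theorem card_stabilizer_pair [Finite G] {π : M →* T} (hπ : Function.Surjective π) {v w : V}
    (hvw : IsCrossing Γ M v w)
    (hU : (MulAction.stabilizer M v ⊓ MulAction.stabilizer M w).map π ≠ ⊤)
    (x : (h.pair π hvw).V) : Nat.card (MulAction.stabilizer (h.pair π hvw).group x) =
      Nat.card ((MulAction.stabilizer M v ⊓ MulAction.stabilizer M w).map π) :=
  card_stabilizer_cosetPair hπ hU (h.inv_mem_nearSet hvw) x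

theorem card_stabilizer_le_absoluteBound [M.Normal] [Finite V] [Finite G] [FaithfulSMul G V]
    (hM : IsMinimalNormal M) {π : M →* T} (hπ : Function.Surjective π) {d : ℕ}
    (hd : ∀ x, (Γ.neighborSet x).ncard ≤ d) (hd0 : 0 < d)
    (hcase : d ≤ 2 ∨ (∃ x, (ballStabilizer Γ M x).map π = ⊥) ∨
      ∀ x : V, (MulAction.stabilizer M x).map π = ⊤) (x : V) :
    Nat.card (MulAction.stabilizer G x) ≤ absoluteBound d := by
  by_cases hd2 : d ≤ 2
  · exact (h.card_stabilizer_le_of_valency_le_two hd hd2 x).trans (le_absoluteBound hd0)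
  · obtain ⟨v, w, hvw⟩ := h.exists_isCrossing
    exact (h.card_stabilizer_le hd v x).trans (mul_factorial_le_absoluteBound (by omega)
      Nat.card_pos (h.card_stabilizer_normal_le_absolute hM hπ hd (hcase.resolve_left hd2) hvw))

/-- Either edge alone bounds the images of all vertex stabilisers, so the smaller of the two bounds
may be used in `card_stabilizer_normal_le_pow`. -/
theorem card_stabilizer_le_starBar [M.Normal] [Finite V] [Finite G] [FaithfulSMul G V]
    (hM : IsMinimalNormal M) {π : M →* T} (hπ : Function.Surjective π) {d : ℕ}
    (hd : ∀ x, (Γ.neighborSet x).ncard ≤ d) (hd3 : 3 ≤ d)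
    (hball : ∀ x, (ballStabilizer Γ M x).map π ≠ ⊥)
    (hne : ∃ x : V, (MulAction.stabilizer M x).map π ≠ ⊤) {v w v' w' : V}
    (hvw : IsCrossing Γ M v w) (hvw' : IsCrossing Γ M v' w') {g₁ g₂ : ℕ → ℕ}
    (h₁ : Nat.card ((MulAction.stabilizer M v ⊓ MulAction.stabilizer M w).map π) ≤
      g₁ (d * (d - 1)))
    (h₂ : Nat.card ((MulAction.stabilizer M v' ⊓ MulAction.stabilizer M w').map π) ≤
      g₂ (d * (d - 1))) (x : V) :
    Nat.card (MulAction.stabilizer G x) ≤ starBar g₁ g₂ d := by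
  have : Finite T := Finite.of_surjective π hπ
  refine (h.card_stabilizer_le hd v x).trans (mul_factorial_le_starBar hd3 Nat.card_pos rfl
    (le_min ((hvw.two_le_card_map_inf_stabilizer hball).trans h₁)
      ((hvw'.two_le_card_map_inf_stabilizer hball).trans h₂)) ?_)
  refine h.card_stabilizer_normal_le_pow hM hπ hd (by omega) (fun y => ?_) hne v
  rcases min_choice (g₁ (d * (d - 1))) (g₂ (d * (d - 1))) with e | e <;> rw [e]
  · exact (h.card_map_stabilizer_le_mul π hd hvw y).trans (Nat.mul_le_mul_left d h₁)
  · exact (h.card_map_stabilizer_le_mul π hd hvw' y).trans (Nat.mul_le_mul_left d h₂)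

end IsTwoOrbitAction
end Reduction

namespace GraphPair

/-- `L₁` and `L₂` witness the reduction of the biquasiprimitive pair `P` to simple groups. -/
def IsSimpleReduction (P L₁ L₂ : GraphPair.{u}) : Prop :=
  ∀ (d : ℕ), 0 < d → ∀ (T : Type v) [Group T],
    P.InA d → IsBiquasiprimitive P.group P.V → IsSocleFactor P.group T →
      P.IsBounded d absoluteBound ∨
      ((L₁.InA (d * (d - 1)) ∧ Nonempty (L₁.group ≃* T)) ∧
        (L₂.InA (d * (d - 1)) ∧ Nonempty (L₂.group ≃* T)) ∧
        (∀ g₁ g₂ : ℕ → ℕ, L₁.IsBounded (d * (d - 1)) g₁ →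
          L₂.IsBounded (d * (d - 1)) g₂ → P.IsBounded d (starBar g₁ g₂)) ∧
        (∀ f : ℕ → ℕ, P.IsBounded d f →
          L₁.IsBounded (d * (d - 1)) (tilde f) ∧ L₂.IsBounded (d * (d - 1)) (tilde f)))

theorem Iso.isSimpleReduction {P Q : GraphPair.{u}} (h : P.Iso Q) {L₁ L₂ : GraphPair.{u}}
    (hP : IsSimpleReduction.{u, v} P L₁ L₂) : IsSimpleReduction.{u, v} Q L₁ L₂ := by
  intro d hd T _ h1 h2 h3
  obtain ⟨e, s, he⟩ := h.symm.exists_equivariant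
  rcases hP d hd T (h.symm.inA h1) (h2.transport s e.toEquiv he) (h3.transport s) with
    h4 | ⟨h4, h5, h6, h7⟩
  · exact Or.inl (h.isBounded h4)
  · exact Or.inr ⟨h4, h5, fun g₁ g₂ h8 h9 => h.isBounded (h6 g₁ g₂ h8 h9),
      fun f hf => h7 f (h.symm.isBounded hf)⟩

/-- The graphs must serve all `d` and `T` at once: the construction does not involve `d`, and `T` is
determined up to isomorphism by the socle. -/
theorem exists_isSimpleReduction (P : GraphPair.{u}) :
    ∃ L₁ L₂ : GraphPair.{u}, IsSimpleReduction.{u, v} P L₁ L₂ := by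
  by_cases hex : ∃ (d : ℕ) (T : Type v) (_ : Group T),
      P.InA d ∧ IsBiquasiprimitive P.group P.V ∧ IsSocleFactor P.group T
  swap
  · exact ⟨P, P, fun d _ T _ h1 h2 h3 => absurd ⟨d, T, inferInstance, h1, h2, h3⟩ hex⟩
  obtain ⟨d₁, T₁, _, ⟨hconn, htrans, -⟩, hbi, hsoc⟩ := hex
  have := P.finite
  have : Finite (P.graph ≃g P.graph) := Finite.of_injective _ RelIso.toEquiv_injective
  have : FaithfulSMul P.group P.V :=
    ⟨fun {g g'} hg => Subtype.ext (RelIso.ext fun x => hg x)⟩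
  have hsimple := hsoc.1
  obtain ⟨M, hM, h⟩ := hbi.exists_isTwoOrbitAction (Γ := P.graph) hconn
    (fun g _ _ hvw => g.1.map_rel_iff.2 hvw)
  have : M.Normal := hM.1
  obtain ⟨π, hπ⟩ := exists_surjective_of_isMinimalNormal hsoc hM
  have : Finite T₁ := Finite.of_surjective π hπ
  by_cases hcase : (∃ x, (ballStabilizer P.graph M x).map π = ⊥) ∨
      ∀ x : P.V, (MulAction.stabilizer M x).map π = ⊤
  · exact ⟨P, P, fun d hd T _ h1 _ _ => Or.inl fun x =>
      h.card_stabilizer_le_absoluteBound hM hπ h1.2.2 hd (Or.inr hcase) x⟩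
  · push Not at hcase
    obtain ⟨v, w, hvw⟩ := h.exists_isCrossing
    -- The second graph comes from a translate of the edge that starts in the other orbit; the
    -- estimates hold for any two crossing edges.
    obtain ⟨g, hg⟩ := h.transitive v w
    have hvw' := h.isCrossing_smul g hvw
    have hU := h.map_inf_stabilizer_ne_top hcase.2 hvw
    have hU' := h.map_inf_stabilizer_ne_top hcase.2 hvw'
    refine ⟨h.pair π hvw, h.pair π hvw', fun d hd T _ h1 _ h3 => ?_⟩
    by_cases hd2 : d ≤ 2
    · exact Or.inl fun x =>
        h.card_stabilizer_le_absoluteBound hM hπ h1.2.2 hd (Or.inl hd2) x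
    obtain ⟨t⟩ := h3.nonempty_mulEquiv hsoc
    obtain ⟨e⟩ := nonempty_cosetPair_group_mulEquiv hπ hU (h.inv_mem_nearSet hvw)
    obtain ⟨e'⟩ := nonempty_cosetPair_group_mulEquiv hπ hU' (h.inv_mem_nearSet hvw')
    refine Or.inr ⟨⟨h.pair_inA π h1.2.2 hvw, ⟨e.trans t⟩⟩,
      ⟨h.pair_inA π h1.2.2 hvw', ⟨e'.trans t⟩⟩, fun g₁ g₂ hg₁ hg₂ x => ?_, fun f hf => ?_⟩
    · obtain ⟨y⟩ := (h.pair_inA π h1.2.2 hvw).1.nonempty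
      obtain ⟨y'⟩ := (h.pair_inA π h1.2.2 hvw').1.nonempty
      exact h.card_stabilizer_le_starBar hM hπ h1.2.2 (by omega) hcase.1 hcase.2 hvw hvw'
        ((h.card_stabilizer_pair hπ hvw hU y).ge.trans (hg₁ y))
        ((h.card_stabilizer_pair hπ hvw' hU' y').ge.trans (hg₂ y')) x
    · have htilde : tilde f (d * (d - 1)) = f d := by
        rw [tilde, tildeIndex_mul_pred (by omega)]
      refine ⟨fun x => ?_, fun x => ?_⟩
      · rw [htilde, h.card_stabilizer_pair hπ hvw hU]
        exact (card_map_inf_stabilizer_le π v w).trans (hf v)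
      · rw [htilde, h.card_stabilizer_pair hπ hvw' hU']
        exact (card_map_inf_stabilizer_le π (g • v) (g • w)).trans (hf (g • v))

end GraphPair

theorem mainTheorem2 :
    ∃ Λ₁ Λ₂ : GraphPair.{u} → GraphPair.{u},
      -- up to isomorphism, the unordered pair of outputs depends only on the isomorphism class
      (∀ P Q : GraphPair.{u}, P.Iso Q →
        ((Λ₁ P).Iso (Λ₁ Q) ∧ (Λ₂ P).Iso (Λ₂ Q)) ∨ ((Λ₁ P).Iso (Λ₂ Q) ∧ (Λ₂ P).Iso (Λ₁ Q))) ∧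
      ∀ (d : ℕ), 0 < d → ∀ (P : GraphPair.{u}) (T : Type v) [Group T],
        P.InA d → IsBiquasiprimitive P.group P.V → IsSocleFactor P.group T →
          P.IsBounded d absoluteBound ∨
          (((Λ₁ P).InA (d * (d - 1)) ∧ Nonempty ((Λ₁ P).group ≃* T)) ∧
            ((Λ₂ P).InA (d * (d - 1)) ∧ Nonempty ((Λ₂ P).group ≃* T)) ∧
            (∀ g₁ g₂ : ℕ → ℕ, (Λ₁ P).IsBounded (d * (d - 1)) g₁ →
              (Λ₂ P).IsBounded (d * (d - 1)) g₂ → P.IsBounded d (starBar g₁ g₂)) ∧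
            (∀ f : ℕ → ℕ, P.IsBounded d f →
              (Λ₁ P).IsBounded (d * (d - 1)) (tilde f) ∧
              (Λ₂ P).IsBounded (d * (d - 1)) (tilde f))) := by
  classical
  let R : GraphPair.{u} → Set (GraphPair.{u} × GraphPair.{u}) := fun P =>
    {L | GraphPair.IsSimpleReduction.{u, v} P L.1 L.2}
  have hR : ∀ P, (R P).Nonempty := fun P => by
    obtain ⟨L₁, L₂, hL⟩ := P.exists_isSimpleReduction
    exact ⟨(L₁, L₂), hL⟩
  have : Nonempty (GraphPair.{u} × GraphPair.{u}) := ⟨(hR ⟨PUnit, inferInstance, ⊥, ⊥⟩).some⟩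
  -- The choice depends only on the set `R P`, which is the same for isomorphic pairs. Isomorphic
  -- pairs are thus assigned identical outputs.
  let pick : GraphPair.{u} → GraphPair.{u} × GraphPair.{u} := fun P =>
    Classical.epsilon (· ∈ R P)
  have hpick : ∀ P, pick P ∈ R P := fun P => Classical.epsilon_spec (hR P)
  refine ⟨fun P => (pick P).1, fun P => (pick P).2, fun P Q hPQ => ?_,
    fun d hd P T _ => hpick P d hd T⟩
  have hRPQ : R P = R Q := Set.ext fun L => ⟨hPQ.isSimpleReduction, hPQ.symm.isSimpleReduction⟩
  have hPQ' : pick P = pick Q := by simp only [pick, hRPQ]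
  simp only [hPQ']
  exact Or.inl ⟨GraphPair.Iso.refl _, GraphPair.Iso.refl _⟩
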